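/- Let $\eta^*:[0,\pi]\to\mathbb{R}$ be non-decreasing, regularly varying at $0$ with index $\rho\ge 0$ (i.e. $\eta^*>0$ near $0^+$ and $\eta^*(sx)/\eta^*(x)\to s^\rho$ as $x\to0^+$ for every $s>0$), and such that $\lim_{x\to0^+}\eta^*(x)=0$. Let $SV(\eta^*)$ be the class of even measurable functions $L$ on $[-\pi,\pi]$ with $L(\pi)>0$ for which there is a measurable function $\eta$ with $|\eta|\le\eta^*$ on $(0,\pi]$ and \[ L(x)=L(\pi)\exp\Big\{-\int_x^\pi\frac{\eta(s)}{s}\,ds\Big\},\qquad 0<x\le\pi . \] For $\alpha\in(-1,1)$ and $L\in SV(\eta^*)$ let $\mathcal{P}(\alpha,L)$ be the set of laws of real second order stationary processes $(X_k)_{k\in\mathbb{Z}}$ with spectral density $f(x)=|x|^{-\alpha}L(x)$, meaning $\mathrm{cov}(X_{j+k},X_j)=\int_{-\pi}^{\pi}f(x)e^{ikx}\,dx$, and let $\mathcal{G}(\alpha,L)\subset\mathcal{P}(\alpha,L)$ consist of the law of the centred Gaussian process with this spectral density. Let $(t_n)$ be a sequence in $[0,\pi]$ with \[ \lim_{n\to\infty}\eta^*(t_n)(nt_n)^{1/2}=1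 . \] For $\mathcal{M}\in\{\mathcal{P},\mathcal{G}\}$ put \[ R_n(\mathcal{M})=\inf_{\hat\alpha_n}\ \sup_{L\in SV(\eta^*)}\ \sup_{\alpha\in(-1,1)}\ \sup_{\mathbb{P}\in\mathcal{M}(\alpha,L)}\ \mathbb{E}_{\mathbb{P}}\big[\eta^*(t_n)^{-1}|\hat\alpha_n-\alpha|\big], \] where the infimum is over all estimators $\hat\alpha_n=\hat\alpha_n(X_1,\dots,X_n)$, i.e. real-valued measurable functions of the $n$ observations. Then, for both $\mathcal{M}=\mathcal{P}$ and $\mathcal{M}=\mathcal{G}$: if $\rho>0$, then $\liminf_{n\to\infty}R_n(\mathcal{M})>0$; and if $\rho=0$, then $\liminf_{n\to\infty}R_n(\mathcal{M})\ge1$. -/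

import Mathlib

open MeasureTheory ProbabilityTheory Filter Topology Set
open scoped ENNReal

namespace LongMemory

noncomputable section

/-- `g` is regularly varying at `0` (from the right) with index `ρ`. -/
def RegularlyVaryingAtZero (g : ℝ → ℝ) (ρ : ℝ) : Prop :=
  (∀ᶠ x in 𝓝[>] (0 : ℝ), 0 < g x) ∧
    ∀ s : ℝ, 0 < s → Tendsto (fun x => g (s * x) / g x) (𝓝[>] (0 : ℝ)) (𝓝 (s ^ ρ))

/-- The class `SV(η*)`: even measurable functions `L` on `[-π, π]` which can be written on
`(0, π]` as `L x = L π * exp (-∫ s in x..π, η s / s)` with `η` measurable and `|η| ≤ η*`.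
As slowly varying functions are positive, `L π > 0`. The value `L 0` is unconstrained (the
integral may diverge there). -/
structure IsSV (ηs : ℝ → ℝ) (L : ℝ → ℝ) : Prop where
  measurable : Measurable (fun x : Icc (-Real.pi) Real.pi => L x)
  even : ∀ x ∈ Icc (-Real.pi) Real.pi, L (-x) = L x
  pos : 0 < L Real.pi
  repr : ∃ η : ℝ → ℝ, Measurable η ∧ (∀ s ∈ Ioc 0 Real.pi, |η s| ≤ ηs s) ∧
    ∀ x ∈ Ioc 0 Real.pi, L x = L Real.pi * Real.exp (-∫ s in x..Real.pi, η s / s)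

/-- The even function `x ↦ |x| ^ (-α) * L x`. -/
def specDensity (α : ℝ) (L : ℝ → ℝ) (x : ℝ) : ℝ := |x| ^ (-α) * L x

/-- `P`, a measure on the path space `ℤ → ℝ`, is the law of a second order (weakly)
stationary process. -/
structure IsSecondOrderStationary (P : Measure (ℤ → ℝ)) : Prop where
  prob : IsProbabilityMeasure P
  memLp : ∀ t : ℤ, MemLp (fun ω : ℤ → ℝ => ω t) 2 P
  mean_eq : ∀ s t : ℤ, ∫ ω, ω s ∂P = ∫ ω, ω t ∂P
  cov_eq : ∀ s t h : ℤ,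
    cov[fun ω : ℤ → ℝ => ω (s + h), fun ω => ω (t + h); P] =
      cov[fun ω : ℤ → ℝ => ω s, fun ω => ω t; P]

/-- `f` is a spectral density of the law `P`: `f` is nonnegative and integrable on `[-π, π]`
(values at the single point `0` are irrelevant), even, and
`γ(k) = ∫ x in -π..π, f x * exp (i k x)`. -/
structure HasSpectralDensity (P : Measure (ℤ → ℝ)) (f : ℝ → ℝ) : Prop where
  even : ∀ x ∈ Icc (-Real.pi) Real.pi, f (-x) = f x
  nonneg : ∀ x ∈ Icc (-Real.pi) Real.pi, x ≠ 0 → 0 ≤ f x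
  integrable : IntegrableOn f (Icc (-Real.pi) Real.pi)
  autocov : ∀ t k : ℤ, ((cov[fun ω : ℤ → ℝ => ω (t + k), fun ω => ω t; P] : ℝ) : ℂ) =
    ∫ x in (-Real.pi)..Real.pi, (f x : ℂ) * Complex.exp (Complex.I * k * x)

/-- Laws of second order stationary processes with spectral density `f`. -/
def stationaryLaws (f : ℝ → ℝ) : Set (Measure (ℤ → ℝ)) :=
  {P | IsSecondOrderStationary P ∧ HasSpectralDensity P f}

/-- The law of the centred stationary Gaussian process with spectral density `f`
(as a set of laws). -/
def gaussianLaws (f : ℝ → ℝ) : Set (Measure (ℤ → ℝ)) :=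
  {P | P ∈ stationaryLaws f ∧ IsGaussianProcess (fun (t : ℤ) (ω : ℤ → ℝ) => ω t) P ∧
    ∀ t : ℤ, ∫ ω, ω t ∂P = 0}

/-- The observations `X₁, …, Xₙ`. -/
def observations (n : ℕ) (ω : ℤ → ℝ) : Fin n → ℝ := fun i => ω ((i : ℤ) + 1)

/-- `E_P [c⁻¹ |δ(X₁, …, Xₙ) - α|]`, possibly infinite. -/
def scaledRisk (n : ℕ) (c α : ℝ) (δ : (Fin n → ℝ) → ℝ) (P : Measure (ℤ → ℝ)) : ℝ≥0∞ :=
  ∫⁻ ω, ENNReal.ofReal (c⁻¹ * |δ (observations n ω) - α|) ∂P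

/-- The minimax `L¹` risk, with error scaled by `c⁻¹`, for the estimation of `α ∈ (-1, 1)` from
`n` observations over `SV(η*)`, where `laws f` is the set of laws allowed for the process
when its spectral density is `f`. -/
def svMinimaxRisk (laws : (ℝ → ℝ) → Set (Measure (ℤ → ℝ))) (ηs : ℝ → ℝ) (c : ℝ) (n : ℕ) : ℝ≥0∞ :=
  ⨅ (δ : (Fin n → ℝ) → ℝ) (_ : Measurable δ),
    ⨆ (L : ℝ → ℝ) (_ : IsSV ηs L) (α : ℝ) (_ : α ∈ Ioo (-1 : ℝ) 1)
      (P : Measure (ℤ → ℝ)) (_ : P ∈ laws (specDensity α L)), scaledRisk n c α δ P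

end

end LongMemory

/-!
The bound is Le Cam's two-point method. For small `l > 0` put `τ = l * t n` and `a = ηs τ`, and compare
the two centred Gaussian processes with memory parameters `a` and `-a` whose spectral densities are
`f x = (max |x| τ / |x|) ^ a` and `g x = (max |x| τ / |x|) ^ (-a)`. Both are equal to `1` outside `[-τ, τ]`, and
`L x = (max |x| τ) ^ (± a)` lies in `SV(ηs)` because `ηs` is at least `a` on `[τ, π]`
(`isSV_plateau`). The processes exist because the functions `√f(x) e^{itx}` realise the covariance as
a Gram kernel in `L²`, and a Gram–Schmidt factorisation of that kernel writes the process through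
i.i.d. standard Gaussian variables (`exists_mem_gaussianLaws`).

The covariance matrices `A`, `B` of `n` observations are simultaneously diagonalised, `A = W Wᵀ` and
`B = W D Wᵀ`, so that the two laws of the observations are the images under `W` of `N(0, I)` and
`N(0, D)`. If `v_i` are the rows of `W⁻¹` and `v_i(x)` the associated trigonometric polynomials, then
`d_i - 1 = ∫ (g - f) |v_i(x)|²` with `∫ f |v_i(x)|² = 1`, and `∑ |v_i(x)|² ≤ n / (2π)` because `f ≥ 1`
gives `A ≥ 2π I`. The variance inequality then yields
`∑ (d_i - 1)² ≤ n / (2π) * ∫ (f - g)² / f` (`exists_toeplitz_factorization`), which is at most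
`200 n a² τ` (`integral_specDensity_plateau_le`). By the choice of `t n` this is eventually below
`400 l`. The chi-square divergence of `N(0, D)` from `N(0, I)` is controlled by `∑ (d_i - 1)²`, so the
two laws have affinity at least `1 - 20 √l` (`two_point_pi_gaussian`), and the scaled risk is at least
`ηs (l * t n) / ηs (t n) * (1 - 20 √l)`. Regular variation gives the limit `l ^ ρ * (1 - 20 √l)`
(`le_liminf_svMinimaxRisk`). A small fixed `l` settles `ρ > 0`; letting `l → 0` settles `ρ = 0`. The
class of all stationary laws contains the Gaussian ones, so its risk is at least as large.
-/

namespace LongMemory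

/-! ### Gaussian processes with a prescribed Gram covariance -/

/-- A Gram–Schmidt (Cholesky) factorisation of the Gram matrix of a sequence of vectors. -/
theorem exists_lowerTriangular_gram {E : Type*} [NormedAddCommGroup E] [InnerProductSpace ℝ E]
    (v : ℕ → E) :
    ∃ c : ℕ → ℕ → ℝ, (∀ k j, k < j → c k j = 0) ∧
      ∀ k l N, k < N → l < N → ∑ j ∈ Finset.range N, c k j * c l j = inner ℝ (v k) (v l) := by
  classical
  set g := InnerProductSpace.gramSchmidt ℝ v with hg
  -- If the vectors are dependent, some `g j` vanish, and division by zero gives `c k j = 0`.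
  set c : ℕ → ℕ → ℝ := fun k j => inner ℝ (g j) (v k) / ‖g j‖ with hc
  have htri : ∀ k j, k < j → c k j = 0 := by
    intro k j h
    simp [hc, hg, InnerProductSpace.gramSchmidt_inv_triangular ℝ v h]
  refine ⟨c, htri, ?_⟩
  have hexp : ∀ k N, k < N → v k = ∑ j ∈ Finset.range N, (c k j / ‖g j‖) • g j := by
    intro k N hk
    have h1 : v k = ∑ j ∈ Finset.range (k + 1), (c k j / ‖g j‖) • g j := by
      conv_lhs => rw [InnerProductSpace.gramSchmidt_def'' ℝ v k]
      rw [Finset.sum_range_succ, add_comm]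
      have hI : Finset.Iio k = Finset.range k := by ext; simp
      rw [hI]
      congr 1
      · refine Finset.sum_congr rfl fun j _ => ?_
        simp [hc, hg, div_div, sq]
      · have : inner ℝ (g k) (v k) = ‖g k‖ ^ 2 := by
          conv_lhs => rw [InnerProductSpace.gramSchmidt_def'' ℝ v k]
          rw [inner_add_right, inner_sum]
          rw [Finset.sum_eq_zero, add_zero, real_inner_self_eq_norm_sq]
          intro j hj
          rw [inner_smul_right, InnerProductSpace.gramSchmidt_orthogonal ℝ v (by simp at hj; omega),
            mul_zero]
        by_cases h0 : g k = 0
        · simp [← hg, h0]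
        · have : ‖g k‖ ≠ 0 := by simpa using h0
          have h2 : c k k / ‖g k‖ = 1 := by
            simp only [hc]; rw [‹inner ℝ (g k) (v k) = _›]; field_simp
          rw [h2, one_smul]
    rw [h1]
    refine Finset.sum_subset (by intro x; simp; omega) ?_
    intro j _ hj
    have : k < j := by simp at hj; omega
    simp [htri k j this]
  intro k l N hk hl
  conv_rhs => rw [hexp k N hk, sum_inner]
  refine Finset.sum_congr rfl fun j _ => ?_
  rw [real_inner_smul_left]
  simp only [hc]
  ring

/-- Gaussianity and the first two moments of independent centred Gaussian coordinates with variances `d`. -/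
theorem moments_of_iIndepFun_gaussianReal {ι : Type*} {Q : Measure (ι → ℝ)}
    {d : ι → NNReal} (hind : iIndepFun (fun (j : ι) (ω : ι → ℝ) => ω j) Q)
    (hmp : ∀ j, Q.map (fun ω : ι → ℝ => ω j) = gaussianReal 0 (d j)) :
    (∀ j, HasGaussianLaw (fun ω : ι → ℝ => ω j) Q) ∧ (∀ j, ∫ ω : ι → ℝ, ω j ∂Q = 0) ∧
      (∀ j, cov[fun ω : ι → ℝ => ω j, fun ω => ω j; Q] = d j) ∧
      ∀ i j, i ≠ j → cov[fun ω : ι → ℝ => ω i, fun ω => ω j; Q] = 0 := by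
  have hme : ∀ j, AEMeasurable (fun ω : ι → ℝ => ω j) Q :=
    fun j => (measurable_pi_apply j).aemeasurable
  have hlaw : ∀ j, HasGaussianLaw (fun ω : ι → ℝ => ω j) Q := fun j => ⟨by
    rw [hmp]; infer_instance⟩
  have hm2 : ∀ j, MemLp (fun ω : ι → ℝ => ω j) 2 Q := fun j => (hlaw j).memLp_two
  refine ⟨hlaw, fun j => ?_, fun j => ?_, fun i j hij =>
    (hind.indepFun hij).covariance_eq_zero (hm2 i) (hm2 j)⟩
  · rw [← integral_map (φ := fun ω : ι → ℝ => ω j) (f := fun x => x) (hme j) (by fun_prop), hmp]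
    exact integral_id_gaussianReal
  · rw [covariance_self (hme j)]
    have h1 := variance_map (μ := Q) (X := id) (Y := fun ω : ι → ℝ => ω j) aemeasurable_id (hme j)
    rw [hmp, variance_id_gaussianReal] at h1
    simpa [Function.comp_def] using h1.symm

/-- Kolmogorov's existence theorem for Gaussian sequences whose covariance is a Gram kernel: a
lower triangular factorisation writes each variable as a finite combination of i.i.d. standard
Gaussian variables. -/
theorem exists_gaussian_process_of_gram {E : Type*} [NormedAddCommGroup E] [InnerProductSpace ℝ E]
    (v : ℤ → E) :
    ∃ P : Measure (ℤ → ℝ), IsProbabilityMeasure P ∧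
      IsGaussianProcess (fun (t : ℤ) (ω : ℤ → ℝ) => ω t) P ∧
      (∀ t : ℤ, ∫ ω, ω t ∂P = 0) ∧
      ∀ s t : ℤ, cov[fun ω : ℤ → ℝ => ω s, fun ω => ω t; P] = inner ℝ (v s) (v t) := by
  classical
  let e : ℤ ≃ ℕ := Denumerable.eqv ℤ
  obtain ⟨c, htri, hc⟩ := exists_lowerTriangular_gram (fun k => v (e.symm k))
  let Q : Measure (ℕ → ℝ) := Measure.infinitePi (fun _ : ℕ => gaussianReal 0 1)
  have hind : iIndepFun (fun (j : ℕ) (ω : ℕ → ℝ) => ω j) Q := 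
    iIndepFun_infinitePi (X := fun _ x => x) (fun _ => measurable_id)
  have hmp : ∀ j, Q.map (fun ω : ℕ → ℝ => ω j) = gaussianReal 0 1 := fun j =>
    (measurePreserving_eval_infinitePi (fun _ : ℕ => gaussianReal 0 1) j).map_eq
  obtain ⟨hlaw, hmean, hcov1, hcov0⟩ := moments_of_iIndepFun_gaussianReal hind hmp
  have hG : IsGaussianProcess (fun (j : ℕ) (ω : ℕ → ℝ) => ω j) Q := ⟨fun I => by
    exact iIndepFun.hasGaussianLaw (X := fun (i : I) (ω : ℕ → ℝ) => ω i) (fun i => hlaw i)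
      (hind.precomp Subtype.val_injective)⟩
  -- Finite sums suffice because the factorisation is lower triangular along the enumeration `e`.
  let X : ℤ → (ℕ → ℝ) → ℝ := fun t ω => ∑ j ∈ Finset.range (e t + 1), c (e t) j * ω j
  have hXN : ∀ t N, e t < N → X t = fun ω => ∑ j ∈ Finset.range N, c (e t) j * ω j := by
    intro t N hN
    funext ω
    refine Finset.sum_subset (by intro x; simp; omega) fun j _ hj => ?_
    have : e t < j := by simp at hj; omega
    simp [htri _ _ this]
  have hXm : ∀ t, Measurable (X t) := fun t => by fun_prop
  have hXG : IsGaussianProcess X Q := hG.of_isGaussianProcess fun t =>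
    ⟨Finset.range (e t + 1),
      ∑ j : Finset.range (e t + 1), c (e t) j • ContinuousLinearMap.proj (R := ℝ) j, fun ω => by
        simp only [X, _root_.sum_apply, _root_.smul_apply,
          ContinuousLinearMap.proj_apply, Finset.restrict_def, smul_eq_mul]
        rw [← Finset.sum_coe_sort]⟩
  have hm2 : ∀ j, MemLp (fun ω : ℕ → ℝ => ω j) 2 Q := fun j => (hlaw j).memLp_two
  have hXmeas : Measurable fun (ω : ℕ → ℝ) (t : ℤ) => X t ω := measurable_pi_lambda _ hXm
  refine ⟨Q.map fun ω t => X t ω, Measure.isProbabilityMeasure_map hXmeas.aemeasurable,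
    ⟨fun I => ⟨?_⟩⟩, fun t => ?_, fun s t => ?_⟩
  · rw [Measure.map_map (by fun_prop) hXmeas]
    exact (hXG.hasGaussianLaw I).isGaussian_map
  · rw [integral_map hXmeas.aemeasurable (measurable_pi_apply _).aestronglyMeasurable]
    simp only [X]
    rw [integral_finsetSum _ fun j _ => ((hlaw j).integrable.const_mul _)]
    simp [integral_const_mul, hmean]
  · rw [covariance_map (measurable_pi_apply _).aestronglyMeasurable
      (measurable_pi_apply _).aestronglyMeasurable hXmeas.aemeasurable]
    change cov[X s, X t; Q] = _
    rw [hXN s (max (e s) (e t) + 1) (by omega), hXN t (max (e s) (e t) + 1) (by omega),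
      covariance_fun_sum_fun_sum' (fun j _ => (hm2 j).const_mul _) (fun j _ => (hm2 j).const_mul _)]
    simp_rw [covariance_const_mul_left, covariance_const_mul_right]
    have := hc (e s) (e t) (max (e s) (e t) + 1) (by omega) (by omega)
    simp only [Equiv.symm_apply_apply] at this
    rw [← this]
    refine Finset.sum_congr rfl fun j hj => ?_
    rw [Finset.sum_eq_single j (fun i _ hi => by rw [hcov0 _ _ hi.symm]; simp)
      (fun h => absurd hj h), hcov1]
    simp

/-- A Gaussian measure on `ℝ^ι` is determined by the means and covariances of its coordinates. -/
theorem isGaussian_pi_ext {ι : Type*} [Fintype ι] {μ ν : Measure (ι → ℝ)} [IsGaussian μ]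
    [IsGaussian ν] (hm : ∀ i, ∫ x, x i ∂μ = ∫ x, x i ∂ν)
    (hc : ∀ i j, cov[fun x => x i, fun x => x j; μ] = cov[fun x => x i, fun x => x j; ν]) :
    μ = ν := by
  apply (MeasurableEquiv.toLp 2 (_ → ℝ)).map_measurableEquiv_injective
  rw [MeasurableEquiv.coe_toLp, ← PiLp.coe_symm_continuousLinearEquiv 2 ℝ]
  apply IsGaussian.ext
  · rw [integral_map (by fun_prop) (by fun_prop), integral_map (by fun_prop) (by fun_prop)]
    simp only [id_eq]
    rw [ContinuousLinearEquiv.integral_comp_comm, ContinuousLinearEquiv.integral_comp_comm]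
    congr 1
    ext i
    rw [eval_integral, eval_integral]
    · exact hm i
    · exact fun i => (IsGaussian.hasGaussianLaw_id.eval i).integrable
    · exact fun i => (IsGaussian.hasGaussianLaw_id.eval i).integrable
  · ext x y
    rw [PiLp.coe_symm_continuousLinearEquiv, covarianceBilin_apply_pi, covarianceBilin_apply_pi]
    · exact Finset.sum_congr rfl fun i _ => Finset.sum_congr rfl fun j _ => by rw [hc i j]
    · exact fun i => (IsGaussian.hasGaussianLaw_id.eval i).memLp_two
    · exact fun i => (IsGaussian.hasGaussianLaw_id.eval i).memLp_two

/-- A centred Gaussian measure with covariance `W diag(d) Wᵀ` is the image under `W` of a product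
of centred one-dimensional Gaussian laws with variances `d`. -/
theorem eq_map_mulVec_pi_gaussianReal {ι : Type*} [Fintype ι] {μ : Measure (ι → ℝ)}
    [IsGaussian μ] (hm : ∀ i, ∫ x, x i ∂μ = 0) (W : Matrix ι ι ℝ) (d : ι → NNReal)
    (hc : ∀ i j, cov[fun x => x i, fun x => x j; μ] = ∑ k, W i k * d k * W j k) :
    μ = (Measure.pi fun k => gaussianReal 0 (d k)).map (fun x => W.mulVec x) := by
  classical
  set Q := Measure.pi fun k => gaussianReal 0 (d k) with hQ
  have hind : iIndepFun (fun (j : ι) (ω : ι → ℝ) => ω j) Q :=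
    iIndepFun_pi (X := fun _ x => x) (fun _ => aemeasurable_id)
  have hmp : ∀ j, Q.map (fun ω : ι → ℝ => ω j) = gaussianReal 0 (d j) := fun j =>
    (measurePreserving_eval (fun k => gaussianReal 0 (d k)) j).map_eq
  obtain ⟨hlaw, hmean, hcov1, hcov0⟩ := moments_of_iIndepFun_gaussianReal hind hmp
  have hGQ : IsGaussian Q := by
    have := (iIndepFun.hasGaussianLaw hlaw hind).isGaussian_map
    simpa using this
  have hm2 : ∀ j, MemLp (fun ω : ι → ℝ => ω j) 2 Q := fun j => (hlaw j).memLp_two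
  have hL : (fun x => W.mulVec x) = (Matrix.mulVecLin W).toContinuousLinearMap := rfl
  have hWm : Measurable fun x : ι → ℝ => W.mulVec x := by rw [hL]; fun_prop
  have : IsGaussian (Q.map (fun x => W.mulVec x)) := by
    rw [hL]; infer_instance
  refine isGaussian_pi_ext (fun i => ?_) (fun i j => ?_)
  · rw [hm, integral_map hWm.aemeasurable (measurable_pi_apply _).aestronglyMeasurable]
    simp only [Matrix.mulVec, dotProduct]
    rw [integral_finsetSum _ fun j _ => ((hlaw j).integrable.const_mul _)]
    simp [integral_const_mul, hmean]
  · rw [hc, covariance_map (measurable_pi_apply _).aestronglyMeasurable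
      (measurable_pi_apply _).aestronglyMeasurable hWm.aemeasurable]
    simp only [Matrix.mulVec, dotProduct, Function.comp_def]
    rw [covariance_fun_sum_fun_sum (fun j => (hm2 j).const_mul _) (fun j => (hm2 j).const_mul _)]
    simp_rw [covariance_const_mul_left, covariance_const_mul_right]
    refine Finset.sum_congr rfl fun k _ => ?_
    rw [Finset.sum_eq_single k (fun i _ hi => by rw [hcov0 _ _ hi.symm]; simp) (by simp), hcov1]
    ring

/-! ### Le Cam's two-point bound for product Gaussian laws -/

theorem pi_withDensity_ofReal {ι : Type*} [Fintype ι] {μ : Measure ℝ} [IsProbabilityMeasure μ]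
    (r : ι → ℝ → ℝ) (hr : ∀ i x, 0 ≤ r i x) (hi : ∀ i, Integrable (r i) μ) :
    (Measure.pi fun i => μ.withDensity fun x => ENNReal.ofReal (r i x)) =
      (Measure.pi fun _ : ι => μ).withDensity fun x => ENNReal.ofReal (∏ i, r i (x i)) := by
  have hf : ∀ i, IsFiniteMeasure (μ.withDensity fun x => ENNReal.ofReal (r i x)) := fun i =>
    isFiniteMeasure_withDensity_ofReal (hi i).2
  refine Measure.pi_eq fun s hs => ?_
  rw [withDensity_apply _ (MeasurableSet.univ_pi hs), Measure.restrict_pi_pi,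
    ← ofReal_integral_eq_lintegral_ofReal, integral_fintype_prod_eq_prod (fun i x => r i x),
    ENNReal.ofReal_prod_of_nonneg]
  · refine Finset.prod_congr rfl fun i _ => ?_
    rw [withDensity_apply _ (hs i), ← ofReal_integral_eq_lintegral_ofReal]
    · exact (hi i).integrableOn
    · exact ae_of_all _ (hr i)
  · exact fun i _ => integral_nonneg (hr i)
  · exact Integrable.fintype_prod fun i => (hi i).integrableOn
  · exact ae_of_all _ fun x => Finset.prod_nonneg fun i _ => hr i _

/-- The density of `N(0, d)` with respect to `N(0, 1)`, for `d > 0`. -/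
noncomputable def gaussianRatio (d x : ℝ) : ℝ := (√d)⁻¹ * Real.exp (-(d⁻¹ - 1) / 2 * x ^ 2)

theorem gaussianRatio_nonneg (d x : ℝ) : 0 ≤ gaussianRatio d x := by
  unfold gaussianRatio; positivity

theorem gaussianPDFReal_mul_gaussianRatio (d : NNReal) (x : ℝ) :
    gaussianPDFReal 0 1 x * gaussianRatio d x = gaussianPDFReal 0 d x := by
  simp only [gaussianPDFReal, gaussianRatio, sub_zero, NNReal.coe_one, mul_one]
  rw [Real.sqrt_mul (by positivity) (d : ℝ), mul_inv]
  rw [show ∀ a b c e : ℝ, a * b * (c * e) = a * c * (b * e) by intros; ring, ← Real.exp_add]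
  congr 2
  rw [div_eq_mul_inv (-x ^ 2) (2 * (d : ℝ)), mul_inv]
  ring

theorem withDensity_gaussianRatio {d : NNReal} (hd : d ≠ 0) :
    (gaussianReal 0 1).withDensity (fun x => ENNReal.ofReal (gaussianRatio d x)) =
      gaussianReal 0 d := by
  have hm : Measurable (gaussianRatio d) := by unfold gaussianRatio; fun_prop
  rw [gaussianReal_of_var_ne_zero _ one_ne_zero, gaussianReal_of_var_ne_zero _ hd,
    ← withDensity_mul _ (measurable_gaussianPDF 0 1) (by fun_prop)]
  congr 1
  funext x
  simp only [Pi.mul_apply, gaussianPDF]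
  rw [← ENNReal.ofReal_mul (gaussianPDFReal_nonneg _ _ _), gaussianPDFReal_mul_gaussianRatio]

theorem integrable_gaussianRatio {d : NNReal} (hd : d ≠ 0) :
    Integrable (gaussianRatio d) (gaussianReal 0 1) := by
  have hm : Measurable (gaussianRatio d) := by unfold gaussianRatio; fun_prop
  refine ⟨hm.aestronglyMeasurable, ?_⟩
  rw [hasFiniteIntegral_iff_ofReal (ae_of_all _ (gaussianRatio_nonneg d)), ← setLIntegral_univ,
    ← withDensity_apply _ MeasurableSet.univ, withDensity_gaussianRatio hd]
  simp

theorem integral_gaussianRatio {d : NNReal} (hd : d ≠ 0) :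
    ∫ x, gaussianRatio d x ∂gaussianReal 0 1 = 1 := by
  rw [integral_gaussianReal_eq_integral_smul one_ne_zero]
  simp only [smul_eq_mul, gaussianPDFReal_mul_gaussianRatio]
  exact integral_gaussianPDFReal_eq_one 0 hd

theorem gaussianPDFReal_mul_gaussianRatio_sq {d : NNReal} (hd : d ≠ 0) (x : ℝ) :
    gaussianPDFReal 0 1 x * gaussianRatio d x ^ 2 =
      ((√(2 * Real.pi))⁻¹ * (d : ℝ)⁻¹) * Real.exp (-((2 - d) / (2 * d)) * x ^ 2) := by
  have hd' : (d : ℝ) ≠ 0 := by exact_mod_cast hd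
  simp only [gaussianPDFReal, gaussianRatio, sub_zero, NNReal.coe_one, mul_one, mul_pow, inv_pow,
    ← Real.exp_nat_mul]
  rw [Real.sq_sqrt (NNReal.coe_nonneg d)]
  rw [show ∀ a b c e : ℝ, a * b * (c * e) = a * c * (b * e) by intros; ring, ← Real.exp_add]
  congr 2
  push_cast
  field_simp
  ring

theorem integrable_gaussianRatio_sq {d : NNReal} (hd : d ≠ 0) (hd2 : d < 2) :
    Integrable (fun x => gaussianRatio d x ^ 2) (gaussianReal 0 1) := by
  have hd' : (0 : ℝ) < d := by exact_mod_cast pos_iff_ne_zero.2 hd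
  have hd2' : (d : ℝ) < 2 := by exact_mod_cast hd2
  rw [gaussianReal_of_var_ne_zero _ one_ne_zero,
    integrable_withDensity_iff_integrable_smul' (measurable_gaussianPDF 0 1)
      (ae_of_all _ fun _ => gaussianPDF_lt_top)]
  simp only [toReal_gaussianPDF, smul_eq_mul, gaussianPDFReal_mul_gaussianRatio_sq hd]
  exact (integrable_exp_neg_mul_sq (div_pos (by linarith) (by linarith))).const_mul _

theorem integral_gaussianRatio_sq {d : NNReal} (hd : d ≠ 0) (hd2 : d < 2) :
    ∫ x, gaussianRatio d x ^ 2 ∂gaussianReal 0 1 = (√(1 - ((d : ℝ) - 1) ^ 2))⁻¹ := by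
  have hd' : (0 : ℝ) < d := by exact_mod_cast pos_iff_ne_zero.2 hd
  have hd2' : (d : ℝ) < 2 := by exact_mod_cast hd2
  have h2 : (0 : ℝ) < 2 - d := by linarith
  rw [integral_gaussianReal_eq_integral_smul one_ne_zero]
  simp only [smul_eq_mul, gaussianPDFReal_mul_gaussianRatio_sq hd]
  rw [integral_const_mul, integral_gaussian]
  have e1 : Real.pi / ((2 - (d : ℝ)) / (2 * d)) = (2 * Real.pi) * (d / (2 - d)) := by
    field_simp
  have e2 : 1 - ((d : ℝ) - 1) ^ 2 = d ^ 2 * ((2 - d) / d) := by field_simp; ring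
  rw [e1, e2, Real.sqrt_mul (by positivity) (d / (2 - d) : ℝ),
    Real.sqrt_mul (by positivity) ((2 - d) / d : ℝ), Real.sqrt_sq hd'.le,
    mul_inv, ← Real.sqrt_inv ((2 - (d : ℝ)) / d), inv_div]
  have : √(2 * Real.pi) ≠ 0 := by positivity
  field_simp

/-- From `∫ r² = (1 - s)^(-1/2)` with `s = (d - 1)²`, and `(1 - s) * exp (2 s) ≥ 1` for
`s ≤ 1 / 2`. -/
theorem integral_gaussianRatio_sq_le {d : NNReal} (hd : ((d : ℝ) - 1) ^ 2 ≤ 1 / 2) :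
    ∫ x, gaussianRatio d x ^ 2 ∂gaussianReal 0 1 ≤ Real.exp (((d : ℝ) - 1) ^ 2) := by
  have h0 : d ≠ 0 := by rintro rfl; norm_num at hd
  have h2 : d < 2 := by
    have : (d : ℝ) < 2 := by nlinarith
    exact_mod_cast this
  rw [integral_gaussianRatio_sq h0 h2]
  set s := ((d : ℝ) - 1) ^ 2 with hs
  have hs0 : 0 ≤ s := sq_nonneg _
  rw [inv_le_comm₀ (Real.sqrt_pos.2 (by linarith)) (Real.exp_pos _), ← Real.exp_neg]
  apply Real.le_sqrt_of_sq_le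
  rw [← Real.exp_nat_mul]
  have h1 : 1 + 2 * s ≤ Real.exp (2 * s) := by linarith [Real.add_one_le_exp (2 * s)]
  have h3 : Real.exp (((2 : ℕ) : ℝ) * -s) = (Real.exp (2 * s))⁻¹ := by
    rw [← Real.exp_neg]; congr 1; push_cast; ring
  rw [h3, inv_le_comm₀ (Real.exp_pos _) (by linarith)]
  refine le_trans ?_ h1
  rw [inv_le_iff_one_le_mul₀ (by linarith)]
  nlinarith

/-- A likelihood ratio `r` with `∫ r = 1` and `∫ r² ≤ 1 + 2 σ²` has affinity at least `1 - σ`. -/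
theorem integral_min_one_ge {Ω : Type*} [MeasurableSpace Ω] {μ : Measure Ω} [IsProbabilityMeasure μ]
    {r : Ω → ℝ} (hi : Integrable r μ) (hi2 : Integrable (fun x => r x ^ 2) μ)
    (h1 : ∫ x, r x ∂μ = 1) {σ : ℝ} (hσ : 0 < σ) (h2 : ∫ x, r x ^ 2 ∂μ ≤ 1 + 2 * σ ^ 2) :
    1 - σ ≤ ∫ x, min 1 (r x) ∂μ := by
  -- `|1 - r| ≤ σ / 2 + (1 - r)² / (2 σ)` by the arithmetic-geometric mean inequality
  have hpt : ∀ x, (1 + r x) / 2 - (σ / 2 + (1 - 2 * r x + r x ^ 2) / (2 * σ)) / 2 ≤ min 1 (r x) := by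
    intro x
    have h3 : |1 - r x| ≤ σ / 2 + (1 - 2 * r x + r x ^ 2) / (2 * σ) := by
      rw [div_add_div _ _ two_ne_zero (by positivity), le_div_iff₀ (by positivity)]
      nlinarith [sq_nonneg (|1 - r x| - σ), sq_abs (1 - r x)]
    have h4 : min 1 (r x) = (1 + r x - |1 - r x|) / 2 := by
      rcases le_total 1 (r x) with h | h
      · rw [min_eq_left h, abs_of_nonpos (by linarith)]; ring
      · rw [min_eq_right h, abs_of_nonneg (by linarith)]; ring
    linarith
  have hia : Integrable (fun x => (1 + r x) / 2) μ := ((integrable_const 1).add hi).div_const 2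
  have hib' : Integrable (fun x => 1 - 2 * r x + r x ^ 2) μ :=
    ((integrable_const 1).sub (hi.const_mul 2)).add hi2
  have hib : Integrable (fun x => (σ / 2 + (1 - 2 * r x + r x ^ 2) / (2 * σ)) / 2) μ :=
    ((integrable_const _).add (hib'.div_const _)).div_const 2
  have hmin : Integrable (fun x => min 1 (r x)) μ := (integrable_const 1).inf hi
  have key := integral_mono (hia.sub hib) hmin hpt
  refine le_trans ?_ key
  have e1 : ∫ x, (1 + r x) / 2 ∂μ = 1 := by
    rw [integral_div, integral_add (integrable_const 1) hi, h1]; simp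
  have e2 : ∫ x, (1 - 2 * r x + r x ^ 2) ∂μ ≤ 2 * σ ^ 2 := by
    have h3 : Integrable (fun x => 1 - 2 * r x) μ := (integrable_const 1).sub (hi.const_mul 2)
    rw [integral_add h3 hi2, integral_sub (integrable_const 1) (hi.const_mul 2),
      integral_const_mul, h1]
    simp; linarith
  have e3 : ∫ x, (σ / 2 + (1 - 2 * r x + r x ^ 2) / (2 * σ)) / 2 ∂μ ≤ 3 * σ / 4 := by
    rw [integral_div, integral_add (integrable_const _) (hib'.div_const _), integral_div (2 * σ)]
    have : (∫ x, (1 - 2 * r x + r x ^ 2) ∂μ) / (2 * σ) ≤ σ := by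
      rw [div_le_iff₀ (by positivity)]; nlinarith
    rw [integral_const, probReal_univ, one_smul]
    linarith
  simp only [Pi.sub_apply]
  rw [integral_sub hia hib, e1]
  linarith

/-- Le Cam's two-point inequality for product Gaussian laws: if `∑ (d_i - 1)² ≤ σ² ≤ 1/2`, losses
whose sum is at least `Δ` have total risk at least `Δ (1 - σ)`. -/
theorem two_point_pi_gaussian {ι : Type*} [Fintype ι] (d : ι → NNReal) {σ : ℝ} (hσ : 0 < σ)
    (hσ2 : σ ^ 2 ≤ 1 / 2) (hd : ∑ i, ((d i : ℝ) - 1) ^ 2 ≤ σ ^ 2) (φ ψ : (ι → ℝ) → ℝ≥0∞)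
    (hφ : Measurable φ) (hψ : Measurable ψ) {Δ : ℝ} (hΔ : 0 ≤ Δ)
    (h : ∀ x, ENNReal.ofReal Δ ≤ φ x + ψ x) :
    ENNReal.ofReal (Δ * (1 - σ)) ≤
      ∫⁻ x, φ x ∂(Measure.pi fun _ : ι => gaussianReal 0 1) +
        ∫⁻ x, ψ x ∂(Measure.pi fun i => gaussianReal 0 (d i)) := by
  have hd1 : ∀ i, ((d i : ℝ) - 1) ^ 2 ≤ 1 / 2 := fun i =>
    (Finset.single_le_sum (f := fun i => ((d i : ℝ) - 1) ^ 2) (fun _ _ => sq_nonneg _)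
      (Finset.mem_univ i)).trans (hd.trans hσ2)
  have h0 : ∀ i, d i ≠ 0 := fun i hi => by have := hd1 i; rw [hi] at this; norm_num at this
  have h2 : ∀ i, d i < 2 := fun i => by
    have : (d i : ℝ) < 2 := by nlinarith [hd1 i]
    exact_mod_cast this
  set γ := Measure.pi fun _ : ι => gaussianReal 0 1
  set r : (ι → ℝ) → ℝ := fun x => ∏ i, gaussianRatio (d i) (x i) with hr
  have hrm : Measurable r := by simp only [hr, gaussianRatio]; fun_prop
  have hr0 : ∀ x, 0 ≤ r x := fun x => Finset.prod_nonneg fun i _ => gaussianRatio_nonneg _ _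
  have hν : (Measure.pi fun i => gaussianReal 0 (d i)) =
      γ.withDensity fun x => ENNReal.ofReal (r x) := by
    rw [← pi_withDensity_ofReal (fun i => gaussianRatio (d i)) (fun i => gaussianRatio_nonneg _)
      (fun i => integrable_gaussianRatio (h0 i))]
    congr 1
    funext i
    exact (withDensity_gaussianRatio (h0 i)).symm
  have hri : Integrable r γ := Integrable.fintype_prod fun i => integrable_gaussianRatio (h0 i)
  have hri2 : Integrable (fun x => r x ^ 2) γ := by
    simp only [hr, ← Finset.prod_pow]
    exact Integrable.fintype_prod (f := fun i y => gaussianRatio (d i) y ^ 2)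
      fun i => integrable_gaussianRatio_sq (h0 i) (h2 i)
  have hr1 : ∫ x, r x ∂γ = 1 := by
    simp only [hr, γ]
    rw [integral_fintype_prod_eq_prod (fun i y => gaussianRatio (d i) y)]
    simp [integral_gaussianRatio (h0 _)]
  have hr2 : ∫ x, r x ^ 2 ∂γ ≤ 1 + 2 * σ ^ 2 := by
    simp only [hr, γ, ← Finset.prod_pow]
    rw [integral_fintype_prod_eq_prod (fun i y => gaussianRatio (d i) y ^ 2)]
    calc _ ≤ ∏ i, Real.exp (((d i : ℝ) - 1) ^ 2) := Finset.prod_le_prod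
          (fun i _ => integral_nonneg fun _ => sq_nonneg _)
          (fun i _ => integral_gaussianRatio_sq_le (hd1 i))
      _ = Real.exp (∑ i, ((d i : ℝ) - 1) ^ 2) := (Real.exp_sum _ _).symm
      _ ≤ Real.exp (σ ^ 2) := Real.exp_le_exp.2 hd
      _ ≤ 1 + 2 * σ ^ 2 := by
        have h3 := Real.abs_exp_sub_one_sub_id_le (x := σ ^ 2)
          (by rw [abs_of_nonneg (sq_nonneg _)]; linarith)
        have h4 := (abs_le.1 h3).2
        nlinarith [sq_nonneg σ]
  have haff := integral_min_one_ge hri hri2 hr1 hσ hr2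
  rw [hν, lintegral_withDensity_eq_lintegral_mul _ (by fun_prop) hψ, ← lintegral_add_left hφ]
  calc ENNReal.ofReal (Δ * (1 - σ)) ≤ ENNReal.ofReal (Δ * ∫ x, min 1 (r x) ∂γ) :=
        ENNReal.ofReal_le_ofReal (mul_le_mul_of_nonneg_left haff hΔ)
    _ = ∫⁻ x, ENNReal.ofReal Δ * ENNReal.ofReal (min 1 (r x)) ∂γ := by
        have hmin : Integrable (fun x => min 1 (r x)) γ := (integrable_const 1).inf hri
        rw [ENNReal.ofReal_mul hΔ, ofReal_integral_eq_lintegral_ofReal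
          hmin (ae_of_all _ fun x => le_min zero_le_one (hr0 x)),
          lintegral_const_mul _ (by fun_prop)]
    _ ≤ _ := lintegral_mono fun x => by
        simp only [Pi.mul_apply]
        calc _ ≤ (φ x + ψ x) * ENNReal.ofReal (min 1 (r x)) := by gcongr; exact h x
          _ = φ x * ENNReal.ofReal (min 1 (r x)) + ENNReal.ofReal (min 1 (r x)) * ψ x := by ring
          _ ≤ φ x * 1 + ENNReal.ofReal (r x) * ψ x := by
            gcongr
            · exact (ENNReal.ofReal_le_ofReal (min_le_left _ _)).trans (by simp)
            · exact min_le_right _ _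
          _ = _ := by rw [mul_one]

/-! ### Covariance matrices of stationary sequences -/

open scoped Matrix in
theorem exists_orthogonal_diagonalization {ι : Type*} [Fintype ι] [DecidableEq ι]
    {A : Matrix ι ι ℝ} (hA : A.IsHermitian) :
    ∃ U : Matrix ι ι ℝ, Uᵀ * U = 1 ∧ A = U * Matrix.diagonal hA.eigenvalues * Uᵀ := by
  refine ⟨hA.eigenvectorUnitary, ?_, ?_⟩
  · have := Unitary.coe_star_mul_self hA.eigenvectorUnitary
    simpa [Matrix.star_eq_conjTranspose] using this
  · have := hA.spectral_theorem
    simpa [Unitary.conjStarAlgAut_apply, Matrix.star_eq_conjTranspose, Function.comp_def] using this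

open scoped Matrix in
/-- Simultaneous diagonalisation of a positive definite and a positive semidefinite matrix by
congruence. -/
theorem exists_simultaneous_diagonalization {ι : Type*} [Fintype ι] [DecidableEq ι]
    {A B : Matrix ι ι ℝ} (hA : A.PosDef) (hB : B.PosSemidef) :
    ∃ (W V : Matrix ι ι ℝ) (d : ι → NNReal), V * W = 1 ∧ A = W * Wᵀ ∧
      B = W * Matrix.diagonal (fun i => (d i : ℝ)) * Wᵀ := by
  obtain ⟨S, T, hTS, hAS⟩ : ∃ S T : Matrix ι ι ℝ, T * S = 1 ∧ A = S * Sᵀ := by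
    obtain ⟨U, hU, hAU⟩ := exists_orthogonal_diagonalization hA.1
    have hpos := hA.eigenvalues_pos
    refine ⟨U * Matrix.diagonal fun i => √(hA.1.eigenvalues i),
      Matrix.diagonal (fun i => (√(hA.1.eigenvalues i))⁻¹) * Uᵀ, ?_, ?_⟩
    · rw [Matrix.mul_assoc, ← Matrix.mul_assoc Uᵀ, hU, Matrix.one_mul, Matrix.diagonal_mul_diagonal,
        ← Matrix.diagonal_one]
      congr 1
      funext i
      exact inv_mul_cancel₀ (Real.sqrt_pos.2 (hpos i)).ne'
    · rw [Matrix.transpose_mul, Matrix.diagonal_transpose, Matrix.mul_assoc,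
        ← Matrix.mul_assoc (Matrix.diagonal _), Matrix.diagonal_mul_diagonal, ← Matrix.mul_assoc]
      conv_lhs => rw [hAU]
      congr 3
      funext i
      exact (Real.mul_self_sqrt (hpos i).le).symm
  have hST : S * T = 1 := mul_eq_one_comm.1 hTS
  obtain ⟨C, hC⟩ : ∃ C, C = T * B * Tᵀ := ⟨_, rfl⟩
  have hCp : C.PosSemidef := by
    have := hB.mul_mul_conjTranspose_same T
    simpa [hC] using this
  obtain ⟨U, hU, hCU⟩ := exists_orthogonal_diagonalization hCp.1
  have hUU : U * Uᵀ = 1 := mul_eq_one_comm.1 hU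
  refine ⟨S * U, Uᵀ * T, fun i => (hCp.1.eigenvalues i).toNNReal, ?_, ?_, ?_⟩
  · rw [Matrix.mul_assoc, ← Matrix.mul_assoc T, hTS, Matrix.one_mul, hU]
  · rw [Matrix.transpose_mul, Matrix.mul_assoc, ← Matrix.mul_assoc U, hUU, Matrix.one_mul, hAS]
  · calc B = (S * T) * B * (S * T)ᵀ := by rw [hST]; simp
      _ = S * C * Sᵀ := by simp only [hC, Matrix.transpose_mul, Matrix.mul_assoc]
      _ = S * (U * Matrix.diagonal hCp.1.eigenvalues * Uᵀ) * Sᵀ := by rw [← hCU]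
      _ = _ := by
        simp only [Matrix.transpose_mul, Matrix.mul_assoc,
          Real.coe_toNNReal _ (hCp.eigenvalues_nonneg _)]

/-- The squared modulus `|∑ v_j e^{ijx}|²` of a trigonometric polynomial. -/
noncomputable def trigSq {n : ℕ} (v : Fin n → ℝ) (x : ℝ) : ℝ :=
  (∑ i, v i * Real.cos (i * x)) ^ 2 + (∑ i, v i * Real.sin (i * x)) ^ 2

/-- The covariance matrix of `n` consecutive observations with even spectral density `f`; evenness
reduces `e^{ikx}` to `cos (k x)`. -/
noncomputable def toeplitz (f : ℝ → ℝ) (n : ℕ) : Matrix (Fin n) (Fin n) ℝ :=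
  fun i j => ∫ x in (-Real.pi)..Real.pi, f x * Real.cos (((i : ℝ) - j) * x)

theorem trigSq_eq_sum {n : ℕ} (v : Fin n → ℝ) (x : ℝ) :
    trigSq v x = ∑ i, ∑ j, v i * v j * Real.cos (((i : ℝ) - j) * x) := by
  simp only [trigSq, sq, Finset.sum_mul_sum, ← Finset.sum_add_distrib]
  refine Finset.sum_congr rfl fun i _ => Finset.sum_congr rfl fun j _ => ?_
  rw [sub_mul, Real.cos_sub]
  ring

theorem trigSq_nonneg {n : ℕ} (v : Fin n → ℝ) (x : ℝ) : 0 ≤ trigSq v x := by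
  unfold trigSq; positivity

theorem continuous_trigSq {n : ℕ} (v : Fin n → ℝ) : Continuous (trigSq v) := by
  unfold trigSq; fun_prop

theorem dotProduct_toeplitz_mulVec {f : ℝ → ℝ} {n : ℕ}
    (hf : IntervalIntegrable f volume (-Real.pi) Real.pi) (v : Fin n → ℝ) :
    v ⬝ᵥ (toeplitz f n).mulVec v = ∫ x in (-Real.pi)..Real.pi, f x * trigSq v x := by
  have hc : ∀ k : ℝ, IntervalIntegrable (fun x => f x * Real.cos (k * x)) volume
      (-Real.pi) Real.pi := fun k => hf.mul_continuousOn (by fun_prop)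
  have e : ∀ x, f x * trigSq v x =
      ∑ i, ∑ j, v i * v j * (f x * Real.cos (((i : ℝ) - j) * x)) := by
    intro x
    rw [trigSq_eq_sum, Finset.mul_sum]
    refine Finset.sum_congr rfl fun i _ => ?_
    rw [Finset.mul_sum]
    exact Finset.sum_congr rfl fun j _ => by ring
  simp_rw [e]
  rw [intervalIntegral.integral_finsetSum]
  · simp only [dotProduct, Matrix.mulVec, toeplitz]
    refine Finset.sum_congr rfl fun i _ => ?_
    rw [intervalIntegral.integral_finsetSum fun j _ => (hc _).const_mul _, Finset.mul_sum]
    refine Finset.sum_congr rfl fun j _ => ?_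
    rw [intervalIntegral.integral_const_mul]
    ring
  · intro i _
    simpa only [Finset.sum_fn] using IntervalIntegrable.sum Finset.univ
      (f := fun j x => v i * v j * (f x * Real.cos (((i : ℝ) - j) * x)))
      fun j _ => (hc _).const_mul _

theorem integral_trigSq {n : ℕ} (v : Fin n → ℝ) :
    ∫ x in (-Real.pi)..Real.pi, trigSq v x = 2 * Real.pi * (v ⬝ᵥ v) := by
  have h := dotProduct_toeplitz_mulVec (f := fun _ => 1) (by simp) v
  simp only [one_mul] at h
  have ht : toeplitz (fun _ => 1) n = (2 * Real.pi) • (1 : Matrix (Fin n) (Fin n) ℝ) := by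
    ext i j
    simp only [toeplitz, one_mul, Matrix.smul_apply, Matrix.one_apply, smul_eq_mul]
    split_ifs with hij
    · subst hij
      simp; ring
    · have hk : ((i : ℝ) - j) ≠ 0 := by
        rw [sub_ne_zero]
        exact_mod_cast fun h => hij (Fin.ext h)
      have hs : ∀ m : ℤ, Real.sin (m * Real.pi) = 0 := Real.sin_int_mul_pi
      rw [intervalIntegral.integral_comp_mul_left _ hk, integral_cos]
      have h1 := hs ((i : ℤ) - j)
      push_cast at h1
      rw [mul_neg, Real.sin_neg, h1]
      simp
  rw [← h, ht, Matrix.smul_mulVec, Matrix.one_mulVec, dotProduct_smul, smul_eq_mul]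

theorem posSemidef_toeplitz {f : ℝ → ℝ} (n : ℕ)
    (hf : IntervalIntegrable f volume (-Real.pi) Real.pi)
    (h0 : ∀ᵐ x ∂volume.restrict (Ioc (-Real.pi) Real.pi), 0 ≤ f x) :
    (toeplitz f n).PosSemidef := by
  refine Matrix.PosSemidef.of_dotProduct_mulVec_nonneg ?_ fun v => ?_
  · ext i j
    simp only [Matrix.conjTranspose_apply, toeplitz, star_trivial]
    congr 1
    funext x
    rw [← Real.cos_neg]
    congr 2
    ring
  · simp only [star_trivial]
    rw [dotProduct_toeplitz_mulVec hf]
    rw [intervalIntegral.integral_of_le (by linarith [Real.pi_pos])]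
    refine integral_nonneg_of_ae ?_
    filter_upwards [h0] with x hx using mul_nonneg hx (trigSq_nonneg _ _)

theorem two_pi_mul_le_dotProduct_toeplitz {f : ℝ → ℝ} {n : ℕ}
    (hf : IntervalIntegrable f volume (-Real.pi) Real.pi)
    (h1 : ∀ᵐ x ∂volume.restrict (Ioc (-Real.pi) Real.pi), 1 ≤ f x) (v : Fin n → ℝ) :
    2 * Real.pi * (v ⬝ᵥ v) ≤ v ⬝ᵥ (toeplitz f n).mulVec v := by
  rw [dotProduct_toeplitz_mulVec hf, ← integral_trigSq]
  have hle : -Real.pi ≤ Real.pi := by linarith [Real.pi_pos]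
  rw [intervalIntegral.integral_of_le hle, intervalIntegral.integral_of_le hle]
  refine integral_mono_ae ?_ ?_ ?_
  · exact (intervalIntegrable_iff_integrableOn_Ioc_of_le hle).1
      ((continuous_trigSq v).intervalIntegrable _ _)
  · exact (intervalIntegrable_iff_integrableOn_Ioc_of_le hle).1
      (hf.mul_continuousOn (continuous_trigSq v).continuousOn)
  · filter_upwards [h1] with x hx
    nlinarith [trigSq_nonneg v x]

/-- Jensen's inequality for the square of `h / f` under the probability density `f q`, in the
form that `(h - c f)² / f * q` has a nonnegative integral for `c = ∫ h q`. -/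
theorem sq_integral_mul_le {μ : Measure ℝ} {f h q : ℝ → ℝ} (hq : ∀ x, 0 ≤ q x)
    (hf : ∀ᵐ x ∂μ, 0 < f x) (hfq : Integrable (fun x => f x * q x) μ)
    (hhq : Integrable (fun x => h x * q x) μ) (hhfq : Integrable (fun x => h x ^ 2 / f x * q x) μ)
    (h1 : ∫ x, f x * q x ∂μ = 1) :
    (∫ x, h x * q x ∂μ) ^ 2 ≤ ∫ x, h x ^ 2 / f x * q x ∂μ := by
  set c := ∫ x, h x * q x ∂μ with hc
  have key : 0 ≤ ∫ x, (h x ^ 2 / f x * q x - 2 * c * (h x * q x) + c ^ 2 * (f x * q x)) ∂μ := by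
    refine integral_nonneg_of_ae ?_
    filter_upwards [hf] with x hx
    have : h x ^ 2 / f x * q x - 2 * c * (h x * q x) + c ^ 2 * (f x * q x) =
        (h x - c * f x) ^ 2 / f x * q x := by field_simp; ring
    simp only [Pi.zero_apply]
    rw [this]
    exact mul_nonneg (div_nonneg (sq_nonneg _) hx.le) (hq x)
  have i1 : Integrable (fun x => h x ^ 2 / f x * q x - 2 * c * (h x * q x)) μ :=
    hhfq.sub (hhq.const_mul _)
  rw [integral_add i1 (hfq.const_mul _), integral_sub hhfq (hhq.const_mul _), integral_const_mul,
    integral_const_mul, h1, ← hc] at key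
  nlinarith

open scoped Matrix in
/-- If `W Wᵀ ≥ m I` and `V = W⁻¹` then `|V e|² ≤ |e|² / m`. -/
theorem dotProduct_mulVec_inv_le {ι : Type*} [Fintype ι] [DecidableEq ι] {W V : Matrix ι ι ℝ}
    (hVW : V * W = 1) {m : ℝ} (hm : 0 < m)
    (h : ∀ v : ι → ℝ, m * (v ⬝ᵥ v) ≤ v ⬝ᵥ (W * Wᵀ) *ᵥ v) (e : ι → ℝ) :
    (V *ᵥ e) ⬝ᵥ (V *ᵥ e) ≤ (e ⬝ᵥ e) / m := by
  set y := Vᵀ *ᵥ (V *ᵥ e) with hy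
  set s := (V *ᵥ e) ⬝ᵥ (V *ᵥ e) with hs
  have hWV : W * V = 1 := mul_eq_one_comm.1 hVW
  have h1 : y ⬝ᵥ (W * Wᵀ) *ᵥ y = s := by
    have e1 : Wᵀ *ᵥ y = V *ᵥ e := by
      rw [hy, Matrix.mulVec_mulVec, ← Matrix.transpose_mul, hVW, Matrix.transpose_one,
        Matrix.one_mulVec]
    rw [← Matrix.mulVec_mulVec, e1, Matrix.dotProduct_mulVec, ← Matrix.mulVec_transpose, e1]
  have h2 : e ⬝ᵥ y = s := by
    rw [hy, Matrix.dotProduct_mulVec, ← Matrix.mulVec_transpose, Matrix.transpose_transpose]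
  have h3 := h y
  rw [h1] at h3
  have hCS : (e ⬝ᵥ y) ^ 2 ≤ (e ⬝ᵥ e) * (y ⬝ᵥ y) := by
    have := Finset.sum_mul_sq_le_sq_mul_sq Finset.univ e y
    simpa [dotProduct, sq] using this
  rw [h2] at hCS
  have hs0 : 0 ≤ s := Finset.sum_nonneg fun i _ => mul_self_nonneg _
  have he0 : 0 ≤ e ⬝ᵥ e := Finset.sum_nonneg fun i _ => mul_self_nonneg _
  rw [le_div_iff₀ hm]
  rcases hs0.eq_or_lt with h0 | h0
  · rw [← h0]; simpa using he0
  · have : s * (s * m) ≤ s * (e ⬝ᵥ e) := by nlinarith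
    exact le_of_mul_le_mul_left this h0

/-- The vector `e = (e^{ijx})_j` satisfies `|e|² = n`. -/
theorem sum_trigSq_row_le {n : ℕ} {V : Matrix (Fin n) (Fin n) ℝ} {m : ℝ}
    (h : ∀ e : Fin n → ℝ, (V.mulVec e) ⬝ᵥ (V.mulVec e) ≤ (e ⬝ᵥ e) / m) (x : ℝ) :
    ∑ i, trigSq (V i) x ≤ n / m := by
  have h1 := h fun i => Real.cos (i * x)
  have h2 := h fun i => Real.sin (i * x)
  have h3 : ∑ i, trigSq (V i) x = (V.mulVec fun i => Real.cos (i * x)) ⬝ᵥ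
      (V.mulVec fun i => Real.cos (i * x)) + (V.mulVec fun i => Real.sin (i * x)) ⬝ᵥ
      (V.mulVec fun i => Real.sin (i * x)) := by
    simp only [trigSq, Finset.sum_add_distrib, dotProduct, Matrix.mulVec, sq]
  have h4 : ((fun i : Fin n => Real.cos (i * x)) ⬝ᵥ fun i => Real.cos (i * x)) +
      ((fun i : Fin n => Real.sin (i * x)) ⬝ᵥ fun i => Real.sin (i * x)) = n := by
    simp only [dotProduct, ← Finset.sum_add_distrib, ← sq, Real.cos_sq_add_sin_sq]
    simp
  rw [h3, ← h4, add_div]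
  exact add_le_add h1 h2

/-- The covariance matrices of `n` observations under spectral densities `f ≥ 1` and `0 ≤ g ≤ f` are
simultaneously diagonalised, and the relative eigenvalues `d` are close to `1` as soon as
`n ∫ (f - g)² / f` is small. -/
theorem exists_toeplitz_factorization {f g : ℝ → ℝ} (n : ℕ)
    (hf : IntervalIntegrable f volume (-Real.pi) Real.pi)
    (hg : IntervalIntegrable g volume (-Real.pi) Real.pi)
    (hf1 : ∀ᵐ x ∂volume.restrict (Ioc (-Real.pi) Real.pi), 1 ≤ f x)
    (hg0 : ∀ᵐ x ∂volume.restrict (Ioc (-Real.pi) Real.pi), 0 ≤ g x ∧ g x ≤ f x) :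
    ∃ (W : Matrix (Fin n) (Fin n) ℝ) (d : Fin n → NNReal),
      (∀ i j, toeplitz f n i j = ∑ k, W i k * W j k) ∧
      (∀ i j, toeplitz g n i j = ∑ k, W i k * d k * W j k) ∧
      ∑ i, ((d i : ℝ) - 1) ^ 2 ≤
        n / (2 * Real.pi) * ∫ x in (-Real.pi)..Real.pi, (f x - g x) ^ 2 / f x := by
  have hpi := Real.pi_pos
  have hle : -Real.pi ≤ Real.pi := by linarith
  -- `f ≥ 1` makes the first covariance matrix at least `2π I`.
  have hA : (toeplitz f n).PosDef := by
    refine Matrix.PosDef.of_dotProduct_mulVec_pos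
      (posSemidef_toeplitz n hf (hf1.mono fun x hx => zero_le_one.trans hx)).1 fun v hv => ?_
    simp only [star_trivial]
    refine lt_of_lt_of_le ?_ (two_pi_mul_le_dotProduct_toeplitz hf hf1 v)
    have : 0 < v ⬝ᵥ v := by
      have := Matrix.dotProduct_star_self_pos_iff (v := v)
      simpa [hv] using this
    positivity
  have hB := posSemidef_toeplitz n hg (hg0.mono fun x hx => hx.1)
  obtain ⟨W, V, d, hVW, hAW, hBW⟩ := exists_simultaneous_diagonalization hA hB
  refine ⟨W, d, fun i j => ?_, fun i j => ?_, ?_⟩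
  · rw [hAW, Matrix.mul_apply]; rfl
  · rw [hBW, Matrix.mul_apply]
    simp [Matrix.mul_diagonal]
  -- The rows of `V = W⁻¹` give trigonometric polynomials with weighted norms `1` and `d i`.
  have hVA : V * toeplitz f n * V.transpose = 1 := by
    rw [hAW, ← Matrix.mul_assoc, hVW, Matrix.one_mul, ← Matrix.transpose_mul, hVW,
      Matrix.transpose_one]
  have hVB : V * toeplitz g n * V.transpose = Matrix.diagonal (fun i => (d i : ℝ)) := by
    rw [hBW, ← Matrix.mul_assoc, ← Matrix.mul_assoc, hVW, Matrix.one_mul, Matrix.mul_assoc,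
      ← Matrix.transpose_mul, hVW, Matrix.transpose_one, Matrix.mul_one]
  have hquad : ∀ (M : Matrix (Fin n) (Fin n) ℝ) i,
      V i ⬝ᵥ M.mulVec (V i) = (V * M * V.transpose) i i := by
    intro M i
    rw [Matrix.mul_apply, Matrix.dotProduct_mulVec]
    rfl
  set q : Fin n → ℝ → ℝ := fun i => trigSq (V i) with hq
  have hqi : ∀ {u : ℝ → ℝ} (i : Fin n), IntervalIntegrable u volume (-Real.pi) Real.pi →
      IntervalIntegrable (fun x => u x * q i x) volume (-Real.pi) Real.pi := fun i hu =>
    hu.mul_continuousOn (continuous_trigSq _).continuousOn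
  have hd1 : ∀ i, ∫ x in (-Real.pi)..Real.pi, f x * q i x = 1 := by
    intro i
    rw [← dotProduct_toeplitz_mulVec hf, hquad, hVA, Matrix.one_apply_eq]
  have hd2 : ∀ i, ∫ x in (-Real.pi)..Real.pi, g x * q i x = d i := by
    intro i
    rw [← dotProduct_toeplitz_mulVec hg, hquad, hVB, Matrix.diagonal_apply_eq]
  have hhi : IntervalIntegrable (fun x => (f x - g x) ^ 2 / f x) volume (-Real.pi) Real.pi := by
    rw [intervalIntegrable_iff_integrableOn_Ioc_of_le hle] at hf hg ⊢
    refine Integrable.mono hf ?_ ?_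
    · exact (((hf.aestronglyMeasurable.sub hg.aestronglyMeasurable).aemeasurable.pow_const 2).div
        hf.aestronglyMeasurable.aemeasurable).aestronglyMeasurable
    · filter_upwards [hf1, hg0] with x h1 h2
      have h0 : 0 < f x := by linarith
      rw [Real.norm_of_nonneg (by positivity), Real.norm_of_nonneg h0.le, div_le_iff₀ h0]
      nlinarith
  have hdi : ∀ i, ((d i : ℝ) - 1) ^ 2 ≤
      ∫ x in (-Real.pi)..Real.pi, (f x - g x) ^ 2 / f x * q i x := by
    intro i
    have e1 : (d i : ℝ) - 1 = -∫ x in (-Real.pi)..Real.pi, (f x - g x) * q i x := by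
      simp_rw [sub_mul]
      rw [intervalIntegral.integral_sub (hqi i hf) (hqi i hg), hd1, hd2]
      ring
    rw [e1, neg_sq]
    have hh1 := hd1 i
    have a1 := hqi i hf
    have a2 := hqi i (hf.sub hg)
    have a3 := hqi i hhi
    rw [intervalIntegrable_iff_integrableOn_Ioc_of_le hle] at a1 a2 a3
    rw [intervalIntegral.integral_of_le hle] at hh1 ⊢
    rw [intervalIntegral.integral_of_le hle]
    exact sq_integral_mul_le (trigSq_nonneg _) (hf1.mono fun x hx => by linarith) a1 a2 a3 hh1
  have hsum : ∀ x, ∑ i, q i x ≤ n / (2 * Real.pi) :=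
    sum_trigSq_row_le (dotProduct_mulVec_inv_le hVW (by positivity)
      fun v => hAW ▸ two_pi_mul_le_dotProduct_toeplitz hf hf1 v)
  calc ∑ i, ((d i : ℝ) - 1) ^ 2
      ≤ ∑ i, ∫ x in (-Real.pi)..Real.pi, (f x - g x) ^ 2 / f x * q i x :=
        Finset.sum_le_sum fun i _ => hdi i
    _ = ∫ x in (-Real.pi)..Real.pi, ∑ i, (f x - g x) ^ 2 / f x * q i x :=
        (intervalIntegral.integral_finsetSum fun i _ => hqi i hhi).symm
    _ ≤ ∫ x in (-Real.pi)..Real.pi, n / (2 * Real.pi) * ((f x - g x) ^ 2 / f x) := by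
        have b1 : IntervalIntegrable (fun x => ∑ i, (f x - g x) ^ 2 / f x * q i x) volume
          (-Real.pi) Real.pi := by
          simpa only [Finset.sum_fn] using IntervalIntegrable.sum Finset.univ
            (f := fun i x => (f x - g x) ^ 2 / f x * q i x) fun i _ => hqi i hhi
        have b2 := hhi.const_mul (n / (2 * Real.pi))
        rw [intervalIntegrable_iff_integrableOn_Ioc_of_le hle] at b1 b2
        rw [intervalIntegral.integral_of_le hle, intervalIntegral.integral_of_le hle]
        refine integral_mono_ae b1 b2 ?_
        filter_upwards [hf1] with x h1
        rw [← Finset.mul_sum, mul_comm]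
        exact mul_le_mul_of_nonneg_right (hsum x) (div_nonneg (sq_nonneg _) (by linarith))
    _ = _ := intervalIntegral.integral_const_mul _ _

/-! ### Spectral densities that are flat away from the origin -/

theorem inner_sqrt_smul_expMap (a s t : ℝ) (ha : 0 ≤ a) :
    inner ℝ ((√a : ℂ) * Complex.exp (Complex.I * s)) ((√a : ℂ) * Complex.exp (Complex.I * t)) =
      a * Real.cos (s - t) := by
  rw [Complex.inner, mul_comm Complex.I, mul_comm Complex.I, Complex.exp_mul_I, Complex.exp_mul_I,
    ← Complex.ofReal_cos, ← Complex.ofReal_sin, ← Complex.ofReal_cos, ← Complex.ofReal_sin]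
  simp [Real.cos_sub, -Complex.ofReal_cos, -Complex.ofReal_sin]
  linear_combination (Real.cos s * Real.cos t + Real.sin s * Real.sin t) * Real.mul_self_sqrt ha

/-- The cosine transform of an integrable nonnegative `f` is the covariance of a centred Gaussian
sequence: the functions `x ↦ √f(x) e^{itx}` realise it as a Gram kernel in the real Hilbert space
`L²((-π, π]; ℂ)`. -/
theorem exists_gaussian_process_of_density {f : ℝ → ℝ}
    (hf : IntervalIntegrable f volume (-Real.pi) Real.pi)
    (h0 : ∀ᵐ x ∂volume.restrict (Ioc (-Real.pi) Real.pi), 0 ≤ f x) :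
    ∃ P : Measure (ℤ → ℝ), IsProbabilityMeasure P ∧
      IsGaussianProcess (fun (t : ℤ) (ω : ℤ → ℝ) => ω t) P ∧
      (∀ t : ℤ, ∫ ω, ω t ∂P = 0) ∧
      ∀ s t : ℤ, cov[fun ω : ℤ → ℝ => ω s, fun ω => ω t; P] =
        ∫ x in (-Real.pi)..Real.pi, f x * Real.cos (((s : ℝ) - t) * x) := by
  have hle : -Real.pi ≤ Real.pi := by linarith [Real.pi_pos]
  set μ := volume.restrict (Ioc (-Real.pi) Real.pi) with hμ
  have hfi : Integrable f μ := (intervalIntegrable_iff_integrableOn_Ioc_of_le hle).1 hf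
  let v : ℤ → ℝ → ℂ := fun t x => (√(f x) : ℂ) * Complex.exp (Complex.I * ((t * x : ℝ) : ℂ))
  have hv : ∀ t, MemLp (v t) 2 μ := by
    intro t
    have hm : AEStronglyMeasurable (v t) μ := by
      refine AEStronglyMeasurable.mul ?_ (by fun_prop)
      exact (hfi.aestronglyMeasurable.aemeasurable.sqrt.complex_ofReal).aestronglyMeasurable
    rw [memLp_two_iff_integrable_sq_norm hm]
    refine hfi.congr ?_
    filter_upwards [h0] with x hx
    have : ‖Complex.exp (Complex.I * ((t * x : ℝ) : ℂ))‖ = 1 := Complex.norm_exp_I_mul_ofReal _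
    simp only [v, norm_mul, this, mul_one, Complex.norm_real, Real.norm_eq_abs, sq_abs,
      Real.sq_sqrt hx]
  obtain ⟨P, hP, hG, hm, hcov⟩ := exists_gaussian_process_of_gram fun t => (hv t).toLp (v t)
  refine ⟨P, hP, hG, hm, fun s t => ?_⟩
  rw [hcov, L2.inner_def, intervalIntegral.integral_of_le hle]
  refine integral_congr_ae ?_
  filter_upwards [h0, (hv s).coeFn_toLp, (hv t).coeFn_toLp] with x hx h1 h2
  rw [h1, h2]
  simp only [v]
  rw [inner_sqrt_smul_expMap _ _ _ hx, sub_mul]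

theorem integral_eq_zero_of_odd {h : ℝ → ℝ} (c : ℝ)
    (ho : ∀ x ∈ uIcc (-c) c, h (-x) = -h x) : ∫ x in (-c)..c, h x = 0 := by
  have h1 : ∫ x in (-c)..c, h (-x) = ∫ x in (-c)..c, h x := by
    rw [intervalIntegral.integral_comp_neg]; simp
  rw [intervalIntegral.integral_congr ho, intervalIntegral.integral_neg] at h1
  linarith

/-- A nonnegative even integrable function is the spectral density of a centred stationary
Gaussian process. -/
theorem exists_mem_gaussianLaws {f : ℝ → ℝ}
    (heven : ∀ x ∈ Icc (-Real.pi) Real.pi, f (-x) = f x)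
    (h0 : ∀ x ∈ Icc (-Real.pi) Real.pi, x ≠ 0 → 0 ≤ f x)
    (hf : IntervalIntegrable f volume (-Real.pi) Real.pi) :
    ∃ P ∈ gaussianLaws f, ∀ s t : ℤ, cov[fun ω : ℤ → ℝ => ω s, fun ω => ω t; P] =
        ∫ x in (-Real.pi)..Real.pi, f x * Real.cos (((s : ℝ) - t) * x) := by
  have hle : -Real.pi ≤ Real.pi := by linarith [Real.pi_pos]
  have h0' : ∀ᵐ x ∂volume.restrict (Ioc (-Real.pi) Real.pi), 0 ≤ f x := by
    filter_upwards [ae_restrict_mem measurableSet_Ioc,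
      ae_restrict_of_ae (Measure.ae_ne volume (0 : ℝ))] with x hx hx0
    exact h0 x (Ioc_subset_Icc_self hx) hx0
  obtain ⟨P, hP, hG, hm, hcov⟩ := exists_gaussian_process_of_density hf h0'
  refine ⟨P, ⟨⟨⟨hP, fun t => (hG.hasGaussianLaw_eval t).memLp_two, fun s t => by rw [hm, hm],
    fun s t h => ?_⟩, ⟨heven, h0, ?_, fun t k => ?_⟩⟩, hG, hm⟩, hcov⟩
  · rw [hcov, hcov]
    push_cast
    simp
  · exact (intervalIntegrable_iff_integrableOn_Icc_of_le hle).1 hf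
  · rw [hcov]
    have hcos : IntervalIntegrable (fun x => f x * Real.cos (k * x)) volume (-Real.pi) Real.pi :=
      hf.mul_continuousOn (by fun_prop)
    have hsin : IntervalIntegrable (fun x => f x * Real.sin (k * x)) volume (-Real.pi) Real.pi :=
      hf.mul_continuousOn (by fun_prop)
    have hodd : ∫ x in (-Real.pi)..Real.pi, f x * Real.sin (k * x) = 0 := by
      refine integral_eq_zero_of_odd _ fun x hx => ?_
      rw [uIcc_of_le hle] at hx
      rw [heven x hx, mul_neg, Real.sin_neg, mul_neg]
    have e : ∀ x : ℝ, (f x : ℂ) * Complex.exp (Complex.I * k * x) =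
        ((f x * Real.cos (k * x) : ℝ) : ℂ) + ((f x * Real.sin (k * x) : ℝ) : ℂ) * Complex.I := by
      intro x
      rw [show Complex.I * k * x = ((k * x : ℝ) : ℂ) * Complex.I by push_cast; ring,
        Complex.exp_mul_I, ← Complex.ofReal_cos, ← Complex.ofReal_sin]
      push_cast
      ring
    simp_rw [e]
    have hcos' : IntervalIntegrable (fun x => ((f x * Real.cos (k * x) : ℝ) : ℂ)) volume
      (-Real.pi) Real.pi := ⟨hcos.1.ofReal, hcos.2.ofReal⟩
    have hsin' : IntervalIntegrable (fun x => ((f x * Real.sin (k * x) : ℝ) : ℂ)) volume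
      (-Real.pi) Real.pi := ⟨hsin.1.ofReal, hsin.2.ofReal⟩
    rw [intervalIntegral.integral_add hcos' (hsin'.mul_const _),
      intervalIntegral.integral_mul_const, intervalIntegral.integral_ofReal,
      intervalIntegral.integral_ofReal, hodd]
    simp

/-- The slowly varying function equal to `τ ^ α` on `[-τ, τ]` and to `|x| ^ α` outside, for which
the spectral density `|x| ^ (-α) * L x` is flat away from the interval `[-τ, τ]`. -/
noncomputable def plateau (τ α x : ℝ) : ℝ := max |x| τ ^ α

theorem continuous_plateau {τ : ℝ} (hτ : 0 < τ) (α : ℝ) : Continuous (plateau τ α) := by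
  unfold plateau
  exact Continuous.rpow_const (by fun_prop) fun x => Or.inl (lt_max_of_lt_right hτ).ne'

theorem isSV_plateau {ηs : ℝ → ℝ} {τ α : ℝ} (hτ : 0 < τ) (hτπ : τ ≤ Real.pi)
    (h0 : ∀ s ∈ Ioc 0 Real.pi, 0 ≤ ηs s) (h1 : ∀ s ∈ Icc τ Real.pi, |α| ≤ ηs s) :
    IsSV ηs (plateau τ α) := by
  have hpi := Real.pi_pos
  refine ⟨((continuous_plateau hτ α).comp continuous_subtype_val).measurable,
    fun x _ => by simp [plateau], ?_, fun s => if τ ≤ s then α else 0, ?_, fun s hs => ?_,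
    fun x hx => ?_⟩
  · exact Real.rpow_pos_of_pos (lt_max_of_lt_right hτ) _
  · exact Measurable.ite measurableSet_Ici measurable_const measurable_const
  · dsimp only
    split_ifs with h
    · exact h1 s ⟨h, hs.2⟩
    · simpa using h0 s hs
  · have hint : ∀ y, τ ≤ y → y ≤ Real.pi →
        ∫ s in y..Real.pi, (if τ ≤ s then α else 0) / s = α * (Real.log Real.pi - Real.log y) := by
      intro y hy hyπ
      have : ∫ s in y..Real.pi, (if τ ≤ s then α else 0) / s = ∫ s in y..Real.pi, α * s⁻¹ := by
        refine intervalIntegral.integral_congr fun s hs => ?_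
        rw [uIcc_of_le hyπ] at hs
        simp only [if_pos (hy.trans hs.1), div_eq_mul_inv]
      rw [this, intervalIntegral.integral_const_mul, integral_inv_of_pos (hτ.trans_le hy) hpi,
        Real.log_div hpi.ne' (hτ.trans_le hy).ne']
    have hall : ∫ s in x..Real.pi, (if τ ≤ s then α else 0) / s =
        α * (Real.log Real.pi - Real.log (max x τ)) := by
      rcases le_total τ x with h | h
      · rw [max_eq_left h]; exact hint x h hx.2
      · rw [max_eq_right h, ← hint τ le_rfl hτπ]
        have hz : ∀ s ∈ Ioo x τ, (if τ ≤ s then α else 0) / s = 0 := fun s hs => by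
          simp [not_le.2 hs.2]
        have hzero : ∫ s in x..τ, (if τ ≤ s then α else 0) / s = 0 := by
          rw [intervalIntegral.integral_of_le h, integral_Ioc_eq_integral_Ioo]
          exact setIntegral_eq_zero_of_forall_eq_zero hz
        have i1 : IntervalIntegrable (fun s => (if τ ≤ s then α else 0) / s) volume x τ := by
          rw [intervalIntegrable_iff_integrableOn_Ioo_of_le h]
          exact (integrableOn_zero).congr_fun (fun s hs => (hz s hs).symm) measurableSet_Ioo
        have i2 : IntervalIntegrable (fun s => (if τ ≤ s then α else 0) / s) volume τ Real.pi := by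
          have : IntervalIntegrable (fun s => α * s⁻¹) volume τ Real.pi := by
            refine ContinuousOn.intervalIntegrable ?_
            refine continuousOn_const.mul (continuousOn_id.inv₀ fun s hs => ?_)
            rw [uIcc_of_le hτπ] at hs
            exact (hτ.trans_le hs.1).ne'
          refine this.congr fun s hs => ?_
          rw [uIoc_of_le hτπ] at hs
          simp only [if_pos hs.1.le, div_eq_mul_inv]
        rw [← intervalIntegral.integral_add_adjacent_intervals i1 i2, hzero, zero_add]
    have hM : 0 < max x τ := lt_max_of_lt_right hτ
    simp only [plateau, abs_of_pos hpi, abs_of_pos hx.1, max_eq_left hτπ, hall]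
    rw [Real.rpow_def_of_pos hM, Real.rpow_def_of_pos hpi, ← Real.exp_add]
    congr 1
    ring

theorem specDensity_plateau {τ : ℝ} (hτ : 0 < τ) (α : ℝ) {x : ℝ} (hx : x ≠ 0) :
    specDensity α (plateau τ α) x = (max |x| τ / |x|) ^ α := by
  have hx' : 0 < |x| := abs_pos.2 hx
  rw [specDensity, plateau, Real.div_rpow (lt_max_of_lt_right hτ).le hx'.le, Real.rpow_neg hx'.le]
  ring

theorem specDensity_plateau_even (τ α x : ℝ) :
    specDensity α (plateau τ α) (-x) = specDensity α (plateau τ α) x := by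
  simp [specDensity, plateau]

theorem intervalIntegrable_specDensity_plateau {τ α : ℝ} (hτ : 0 < τ) (hα : α < 1) :
    IntervalIntegrable (specDensity α (plateau τ α)) volume (-Real.pi) Real.pi := by
  have h : IntervalIntegrable (fun x : ℝ => |x| ^ (-α)) volume (-Real.pi) Real.pi := by
    refine intervalIntegrable_of_even (fun x => by simp) fun c hc => ?_
    refine (intervalIntegral.intervalIntegrable_rpow' (r := -α) (by linarith)).congr ?_
    intro x hx
    rw [uIoc_of_le hc.le] at hx
    simp only [abs_of_pos hx.1]
  exact h.mul_continuousOn (continuous_plateau hτ α).continuousOn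

theorem one_le_max_div {τ x : ℝ} (hx : x ≠ 0) : 1 ≤ max |x| τ / |x| := by
  rw [le_div_iff₀ (abs_pos.2 hx), one_mul]
  exact le_max_left _ _

/-- `v^a - v^{-a}` is of order `a` up to a small power of `v`. -/
theorem sq_rpow_sub_div_le {v a : ℝ} (hv : 1 ≤ v) (ha : 0 ≤ a) (ha4 : a ≤ 1 / 4) :
    (v ^ a - v ^ (-a)) ^ 2 / v ^ a ≤ 256 * a ^ 2 * v ^ (1 / 2 : ℝ) := by
  have hv0 : 0 < v := by linarith
  have hl0 : 0 ≤ Real.log v := Real.log_nonneg hv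
  have hpa : 0 < v ^ a := Real.rpow_pos_of_pos hv0 _
  have h1 : 0 ≤ v ^ a - v ^ (-a) := sub_nonneg.2 (Real.rpow_le_rpow_of_exponent_le hv (by linarith))
  have h2 : v ^ a - v ^ (-a) ≤ v ^ a * (2 * a * Real.log v) := by
    have : v ^ (-a) = v ^ a * Real.exp (-(2 * a * Real.log v)) := by
      rw [Real.rpow_def_of_pos hv0, Real.rpow_def_of_pos hv0, ← Real.exp_add]
      congr 1; ring
    rw [this]
    nlinarith [Real.add_one_le_exp (-(2 * a * Real.log v))]
  -- The exponent `1/8` leaves `v ^ (a + 1/4) ≤ v ^ (1/2)`, which is integrable for `v = τ / |x|`.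
  have h3 : Real.log v ≤ 8 * v ^ (1 / 8 : ℝ) := by
    have := Real.log_le_rpow_div hv0.le (show (0 : ℝ) < 1 / 8 by norm_num)
    linarith
  have h4 : (v ^ a - v ^ (-a)) ^ 2 ≤ (v ^ a * (2 * a * (8 * v ^ (1 / 8 : ℝ)))) ^ 2 := by
    refine pow_le_pow_left₀ h1 (h2.trans ?_) 2
    gcongr
  rw [div_le_iff₀ hpa]
  refine h4.trans ?_
  have e1 : (v ^ a * (2 * a * (8 * v ^ (1 / 8 : ℝ)))) ^ 2 =
      256 * a ^ 2 * v ^ a * (v ^ a * v ^ (1 / 4 : ℝ)) := by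
    have : v ^ (1 / 4 : ℝ) = v ^ (1 / 8 : ℝ) * v ^ (1 / 8 : ℝ) := by
      rw [← Real.rpow_add hv0]; norm_num
    rw [this]; ring
  have e2 : v ^ a * v ^ (1 / 4 : ℝ) ≤ v ^ (1 / 2 : ℝ) := by
    rw [← Real.rpow_add hv0]
    exact Real.rpow_le_rpow_of_exponent_le hv (by linarith)
  rw [e1]
  calc _ ≤ 256 * a ^ 2 * v ^ a * v ^ (1 / 2 : ℝ) := by gcongr
    _ = _ := by ring

/-- The relative squared distance of the two spectral densities with memory parameters `a`, `-a`. -/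
theorem integral_specDensity_plateau_le {τ a : ℝ} (hτ : 0 < τ) (hτπ : τ ≤ Real.pi) (ha : 0 ≤ a)
    (ha4 : a ≤ 1 / 4) :
    ∫ x in (-Real.pi)..Real.pi, (specDensity a (plateau τ a) x -
      specDensity (-a) (plateau τ (-a)) x) ^ 2 / specDensity a (plateau τ a) x ≤
        1024 * a ^ 2 * τ := by
  have hpi := Real.pi_pos
  have hle : -Real.pi ≤ Real.pi := by linarith
  set F : ℝ → ℝ := fun x => (specDensity a (plateau τ a) x -
      specDensity (-a) (plateau τ (-a)) x) ^ 2 / specDensity a (plateau τ a) x with hF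
  -- The integrand vanishes for `τ ≤ |x|`.
  set G : ℝ → ℝ := (Ioc (-τ) τ).indicator
    fun x => 256 * a ^ 2 * τ ^ (1 / 2 : ℝ) * |x| ^ (-(1 / 2) : ℝ) with hG
  have hFG : ∀ x, x ≠ 0 → F x ≤ G x := by
    intro x hx
    simp only [hF, specDensity_plateau hτ _ hx]
    by_cases h : x ∈ Ioc (-τ) τ
    · rw [hG, indicator_of_mem h]
      refine (sq_rpow_sub_div_le (one_le_max_div hx) ha ha4).trans_eq ?_
      rw [max_eq_right (abs_le.2 ⟨h.1.le, h.2⟩), Real.div_rpow hτ.le (abs_nonneg x),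
        Real.rpow_neg (abs_nonneg x)]
      ring
    · have hτx : τ ≤ |x| := by
        by_contra hlt
        exact h ⟨(abs_lt.1 (not_le.1 hlt)).1, (abs_lt.1 (not_le.1 hlt)).2.le⟩
      rw [hG, indicator_of_notMem h, max_eq_left hτx, div_self (abs_pos.2 hx).ne']
      simp
  have hF0 : ∀ x, x ≠ 0 → 0 ≤ F x := by
    intro x hx
    simp only [hF, specDensity_plateau hτ _ hx]
    have := one_le_max_div (τ := τ) hx
    positivity
  have hr0 : IntervalIntegrable (fun x : ℝ => x ^ (-(1 / 2) : ℝ)) volume 0 τ :=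
    intervalIntegral.intervalIntegrable_rpow' (by norm_num)
  have hr1 : IntervalIntegrable (fun x : ℝ => |x| ^ (-(1 / 2) : ℝ)) volume 0 τ := hr0.congr
    fun x hx => by rw [uIoc_of_le hτ.le] at hx; simp only [abs_of_pos hx.1]
  have hr2 : IntervalIntegrable (fun x : ℝ => |x| ^ (-(1 / 2) : ℝ)) volume (-τ) 0 := by
    rw [IntervalIntegrable.iff_comp_neg]
    simpa using hr1.symm
  have hI1 : ∫ x in (0 : ℝ)..τ, |x| ^ (-(1 / 2) : ℝ) = 2 * τ ^ (1 / 2 : ℝ) := by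
    have : ∫ x in (0 : ℝ)..τ, |x| ^ (-(1 / 2) : ℝ) = ∫ x in (0 : ℝ)..τ, x ^ (-(1 / 2) : ℝ) :=
      intervalIntegral.integral_congr fun x hx => by
        rw [uIcc_of_le hτ.le] at hx; simp only [abs_of_nonneg hx.1]
    rw [this, integral_rpow (Or.inl (by norm_num))]
    norm_num
    ring
  have hI2 : ∫ x in (-τ)..(0 : ℝ), |x| ^ (-(1 / 2) : ℝ) = 2 * τ ^ (1 / 2 : ℝ) := by
    rw [← hI1]
    have := intervalIntegral.integral_comp_neg (a := 0) (b := τ)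
      (fun x : ℝ => |x| ^ (-(1 / 2) : ℝ))
    simpa using this.symm
  have hgi := (hr2.trans hr1).const_mul (256 * a ^ 2 * τ ^ (1 / 2 : ℝ))
  have hsub : Ioc (-Real.pi) Real.pi ∩ Ioc (-τ) τ = Ioc (-τ) τ :=
    inter_eq_right.2 (Ioc_subset_Ioc (by linarith) hτπ)
  have hne : ∀ᵐ x ∂volume.restrict (Ioc (-Real.pi) Real.pi), x ≠ 0 :=
    ae_restrict_of_ae (Measure.ae_ne volume (0 : ℝ))
  have hGi : Integrable G (volume.restrict (Ioc (-Real.pi) Real.pi)) := by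
    rw [hG, integrable_indicator_iff measurableSet_Ioc, IntegrableOn,
      Measure.restrict_restrict measurableSet_Ioc, inter_comm, hsub]
    exact (intervalIntegrable_iff_integrableOn_Ioc_of_le (by linarith)).1 hgi
  calc ∫ x in (-Real.pi)..Real.pi, F x ≤ ∫ x in Ioc (-Real.pi) Real.pi, G x := by
        rw [intervalIntegral.integral_of_le hle]
        exact integral_mono_of_nonneg (hne.mono hF0) hGi (hne.mono hFG)
    _ = ∫ x in (-τ)..τ, 256 * a ^ 2 * τ ^ (1 / 2 : ℝ) * |x| ^ (-(1 / 2) : ℝ) := by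
        rw [hG, setIntegral_indicator measurableSet_Ioc, hsub,
          intervalIntegral.integral_of_le (by linarith)]
    _ = 1024 * a ^ 2 * τ := by
        rw [intervalIntegral.integral_const_mul,
          ← intervalIntegral.integral_add_adjacent_intervals hr2 hr1, hI1, hI2]
        have : τ ^ (1 / 2 : ℝ) * τ ^ (1 / 2 : ℝ) = τ := by
          rw [← Real.rpow_add hτ]; norm_num
        linear_combination 1024 * a ^ 2 * this

/-! ### The minimax lower bound -/

theorem measurable_observations (n : ℕ) : Measurable (observations n) :=
  measurable_pi_lambda _ fun _ => measurable_pi_apply _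

/-- The law of the observations of a Gaussian process, in coordinates that diagonalise its
covariance. -/
theorem map_observations_eq {f : ℝ → ℝ} {P : Measure (ℤ → ℝ)} (hP : P ∈ gaussianLaws f)
    (hcov : ∀ s t : ℤ, cov[fun ω : ℤ → ℝ => ω s, fun ω => ω t; P] =
      ∫ x in (-Real.pi)..Real.pi, f x * Real.cos (((s : ℝ) - t) * x))
    {n : ℕ} (W : Matrix (Fin n) (Fin n) ℝ) (d : Fin n → NNReal)
    (hW : ∀ i j, toeplitz f n i j = ∑ k, W i k * d k * W j k) :
    P.map (observations n) = (Measure.pi fun k => gaussianReal 0 (d k)).map fun x => W.mulVec x := by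
  classical
  obtain ⟨-, hG, hm⟩ := hP
  have ho := (measurable_observations n).aemeasurable (μ := P)
  have hgauss : IsGaussian (P.map (observations n)) := by
    let I : Finset ℤ := Finset.univ.image fun i : Fin n => (i : ℤ) + 1
    let L : (I → ℝ) →L[ℝ] (Fin n → ℝ) := ContinuousLinearMap.pi fun i =>
      ContinuousLinearMap.proj ⟨(i : ℤ) + 1, Finset.mem_image_of_mem _ (Finset.mem_univ i)⟩
    exact ((hG.hasGaussianLaw I).map L).isGaussian_map
  refine eq_map_mulVec_pi_gaussianReal (fun i => ?_) W d fun i j => ?_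
  · rw [integral_map ho (measurable_pi_apply _).aestronglyMeasurable]
    exact hm _
  · rw [covariance_map (measurable_pi_apply _).aestronglyMeasurable
      (measurable_pi_apply _).aestronglyMeasurable ho, ← hW]
    change cov[fun ω : ℤ → ℝ => ω ((i : ℤ) + 1), fun ω => ω ((j : ℤ) + 1); P] = _
    rw [hcov]
    simp [toeplitz]

theorem scaledRisk_eq {P : Measure (ℤ → ℝ)} {n : ℕ} {W : Matrix (Fin n) (Fin n) ℝ}
    {d : Fin n → NNReal} (h : P.map (observations n) =
      (Measure.pi fun k => gaussianReal 0 (d k)).map fun x => W.mulVec x)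
    {δ : (Fin n → ℝ) → ℝ} (hδ : Measurable δ) (c α : ℝ) :
    scaledRisk n c α δ P = ∫⁻ x, ENNReal.ofReal (c⁻¹ * |δ (W.mulVec x) - α|)
      ∂(Measure.pi fun k => gaussianReal 0 (d k)) := by
  have hW : Measurable fun x : Fin n → ℝ => W.mulVec x :=
    (Matrix.mulVecLin W).toContinuousLinearMap.continuous.measurable
  have hm : Measurable fun y => ENNReal.ofReal (c⁻¹ * |δ y - α|) := by fun_prop
  rw [scaledRisk, ← lintegral_map hm (measurable_observations n), h, lintegral_map hm hW]

/-- Le Cam's bound for the two Gaussian models with memory parameters `± ηs τ` whose spectral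
densities are flat outside `[-τ, τ]`. -/
theorem le_svMinimaxRisk_gaussianLaws {ηs : ℝ → ℝ} {τ c σ : ℝ} {n : ℕ} (hτ : 0 < τ)
    (hτπ : τ ≤ Real.pi) (hpos : ∀ s ∈ Ioc 0 Real.pi, 0 < ηs s)
    (hmono : ∀ s ∈ Icc τ Real.pi, ηs τ ≤ ηs s) (h4 : ηs τ ≤ 1 / 4) (hc : 0 < c) (hσ : 0 < σ)
    (hσ2 : σ ^ 2 ≤ 1 / 2) (hn : 200 * (n * ηs τ ^ 2 * τ) ≤ σ ^ 2) :
    ENNReal.ofReal (ηs τ / c * (1 - σ)) ≤ svMinimaxRisk gaussianLaws ηs c n := by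
  set a := ηs τ with ha
  have ha0 : 0 < a := hpos τ ⟨hτ, hτπ⟩
  have hpi := Real.pi_pos
  have hne : ∀ᵐ x ∂volume.restrict (Ioc (-Real.pi) Real.pi), x ≠ 0 :=
    ae_restrict_of_ae (Measure.ae_ne volume (0 : ℝ))
  have hsv : ∀ α, |α| = a → IsSV ηs (plateau τ α) := fun α hα =>
    isSV_plateau hτ hτπ (fun s hs => (hpos s hs).le) fun s hs => hα.trans_le (hmono s hs)
  have hnn : ∀ α x, x ≠ 0 → 0 ≤ specDensity α (plateau τ α) x := fun α x hx => by
    rw [specDensity_plateau hτ α hx]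
    have := one_le_max_div (τ := τ) hx
    positivity
  have hi : ∀ α, α < 1 → IntervalIntegrable (specDensity α (plateau τ α)) volume
    (-Real.pi) Real.pi := fun α hα => intervalIntegrable_specDensity_plateau hτ hα
  have hi1 := hi a (by linarith)
  have hi2 := hi (-a) (by linarith)
  obtain ⟨P₁, hP₁, hcov₁⟩ := exists_mem_gaussianLaws
    (fun x _ => specDensity_plateau_even τ a x) (fun x _ hx => hnn a x hx) hi1
  obtain ⟨P₂, hP₂, hcov₂⟩ := exists_mem_gaussianLaws
    (fun x _ => specDensity_plateau_even τ (-a) x) (fun x _ hx => hnn (-a) x hx) hi2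
  -- The value of the spectral densities at `0` is a junk value, hence the almost everywhere bounds.
  obtain ⟨W, d, hW₁, hW₂, hd⟩ := exists_toeplitz_factorization n hi1 hi2
    (hne.mono fun x hx => by
      rw [specDensity_plateau hτ a hx]
      exact Real.one_le_rpow (one_le_max_div hx) ha0.le)
    (hne.mono fun x hx => ⟨hnn _ x hx, by
      rw [specDensity_plateau hτ _ hx, specDensity_plateau hτ _ hx]
      exact Real.rpow_le_rpow_of_exponent_le (one_le_max_div hx) (by linarith)⟩)
  -- The constant `200` is a convenient upper bound for `1024 / (2π)`.
  have hd' : ∑ i, ((d i : ℝ) - 1) ^ 2 ≤ σ ^ 2 := by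
    refine hd.trans (le_trans ?_ hn)
    calc _ ≤ n / (2 * Real.pi) * (1024 * a ^ 2 * τ) := by
          gcongr
          exact integral_specDensity_plateau_le hτ hτπ ha0.le h4
      _ = 1024 / (2 * Real.pi) * (n * a ^ 2 * τ) := by ring
      _ ≤ 200 * (n * a ^ 2 * τ) := by
          gcongr
          rw [div_le_iff₀ (by positivity)]
          linarith [Real.pi_gt_three]
  have hlaw₁ := map_observations_eq hP₁ hcov₁ W (fun _ => 1) (by simpa using hW₁)
  have hlaw₂ := map_observations_eq hP₂ hcov₂ W d hW₂
  refine le_iInf₂ fun δ hδ => ?_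
  set R := ⨆ (L : ℝ → ℝ) (_ : IsSV ηs L) (α : ℝ) (_ : α ∈ Ioo (-1 : ℝ) 1)
      (P : Measure (ℤ → ℝ)) (_ : P ∈ gaussianLaws (specDensity α L)), scaledRisk n c α δ P with hR
  have hle : ∀ α P, |α| = a → P ∈ gaussianLaws (specDensity α (plateau τ α)) →
      scaledRisk n c α δ P ≤ R := by
    intro α P hα hP
    have hα1 : α ∈ Ioo (-1 : ℝ) 1 := abs_lt.1 (by linarith)
    rw [hR]
    exact le_iSup_of_le (plateau τ α) <| le_iSup_of_le (hsv α hα) <| le_iSup_of_le α <|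
      le_iSup_of_le hα1 <| le_iSup_of_le P <| le_iSup_of_le hP le_rfl
  have h₁ := hle a P₁ (abs_of_pos ha0) hP₁
  have h₂ := hle (-a) P₂ (by rw [abs_neg, abs_of_pos ha0]) hP₂
  rw [scaledRisk_eq hlaw₁ hδ] at h₁
  rw [scaledRisk_eq hlaw₂ hδ] at h₂
  have hWm : Measurable fun x : Fin n → ℝ => W.mulVec x :=
    (Matrix.mulVecLin W).toContinuousLinearMap.continuous.measurable
  have hδW : Measurable fun x : Fin n → ℝ => δ (W.mulVec x) := hδ.comp hWm
  have key := two_point_pi_gaussian d hσ hσ2 hd'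
    (fun x => ENNReal.ofReal (c⁻¹ * |δ (W.mulVec x) - a|))
    (fun x => ENNReal.ofReal (c⁻¹ * |δ (W.mulVec x) - -a|)) (by fun_prop) (by fun_prop)
    (Δ := c⁻¹ * (2 * a)) (by positivity) fun x => by
      rw [← ENNReal.ofReal_add (by positivity) (by positivity), ← mul_add]
      refine ENNReal.ofReal_le_ofReal (mul_le_mul_of_nonneg_left ?_ (by positivity))
      have h1 := neg_abs_le (δ (W.mulVec x) - a)
      have h2 := le_abs_self (δ (W.mulVec x) - -a)
      linarith
  -- The maximum of the two risks is at least half their sum.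
  have h2R : ENNReal.ofReal (2 * (a / c * (1 - σ))) ≤ 2 * R := by
    rw [two_mul R]
    refine le_trans (le_of_eq ?_) (key.trans (add_le_add h₁ h₂))
    congr 1
    ring
  rw [ENNReal.ofReal_mul (by norm_num)] at h2R
  simp only [ENNReal.ofReal_ofNat] at h2R
  exact (ENNReal.mul_le_mul_iff_right (by norm_num) (by norm_num)).1 h2R

theorem svMinimaxRisk_mono {laws laws' : (ℝ → ℝ) → Set (Measure (ℤ → ℝ))}
    (h : ∀ f, laws f ⊆ laws' f) (ηs : ℝ → ℝ) (c : ℝ) (n : ℕ) :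
    svMinimaxRisk laws ηs c n ≤ svMinimaxRisk laws' ηs c n :=
  iInf₂_mono fun _ _ => iSup₂_mono fun _ _ => iSup₂_mono fun _ _ =>
    iSup_mono fun _ => iSup_const_mono (h _ ·)

/-- The balance `ηs (t n) √(n t n) → 1` forces `t n → 0` through positive values. -/
theorem tendsto_nhdsGT_zero_of_balance {ηs : ℝ → ℝ} (hmono : MonotoneOn ηs (Icc 0 Real.pi))
    (hpos : ∀ s ∈ Ioc 0 Real.pi, 0 < ηs s) {t : ℕ → ℝ} (ht : ∀ n, t n ∈ Icc 0 Real.pi)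
    (htlim : Tendsto (fun n : ℕ => ηs (t n) * √(n * t n)) atTop (𝓝 1)) :
    Tendsto t atTop (𝓝[>] 0) := by
  have h0 : ∀ᶠ n in atTop, 0 < t n := by
    filter_upwards [htlim.eventually (lt_mem_nhds one_pos)] with n hn
    refine lt_of_le_of_ne (ht n).1 fun h => ?_
    rw [← h] at hn
    simp at hn
  refine tendsto_nhdsWithin_iff.2 ⟨?_, h0⟩
  refine tendsto_order.2 ⟨fun b hb => h0.mono fun n hn => hb.trans hn, fun b hb => ?_⟩
  set ε := min b Real.pi with hε
  have hε0 : 0 < ε := lt_min hb Real.pi_pos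
  have hεπ : ε ≤ Real.pi := min_le_right _ _
  have hηε := hpos ε ⟨hε0, hεπ⟩
  have hbig : Tendsto (fun n : ℕ => ηs ε * √(n * ε)) atTop atTop :=
    Tendsto.const_mul_atTop hηε (Real.tendsto_sqrt_atTop.comp
      (tendsto_natCast_atTop_atTop.atTop_mul_const hε0))
  filter_upwards [htlim.eventually (gt_mem_nhds one_lt_two), hbig.eventually_ge_atTop 2]
    with n h1 h2
  by_contra hlt
  have hεt : ε ≤ t n := (min_le_left _ _).trans (not_lt.1 hlt)
  have : ηs ε * √(n * ε) ≤ ηs (t n) * √(n * t n) :=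
    mul_le_mul (hmono ⟨hε0.le, hεπ⟩ (ht n) hεt) (Real.sqrt_le_sqrt (by gcongr)) (Real.sqrt_nonneg _)
      (hηε.le.trans (hmono ⟨hε0.le, hεπ⟩ (ht n) hεt))
  linarith

/-- The two-point bound at `τ = l * t n` with `σ = 20 √l`, in the limit: `n ηs(τ)² τ ≤ 2 l` eventually,
so `σ² = 400 l` is admissible, and `l ≤ 1 / 800` gives `σ² ≤ 1 / 2`. -/
theorem le_liminf_svMinimaxRisk {ηs : ℝ → ℝ} {ρ : ℝ} (hmono : MonotoneOn ηs (Icc 0 Real.pi))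
    (hrv : RegularlyVaryingAtZero ηs ρ) (hlim : Tendsto ηs (𝓝[>] (0 : ℝ)) (𝓝 0))
    {t : ℕ → ℝ} (ht : ∀ n, t n ∈ Icc 0 Real.pi)
    (htlim : Tendsto (fun n : ℕ => ηs (t n) * √(n * t n)) atTop (𝓝 1))
    {l : ℝ} (hl : 0 < l) (hl1 : l ≤ 1 / 800) :
    ENNReal.ofReal (l ^ ρ * (1 - 20 * √l)) ≤
      liminf (fun n : ℕ => svMinimaxRisk gaussianLaws ηs (ηs (t n)) n) atTop := by
  have hpos : ∀ s ∈ Ioc 0 Real.pi, 0 < ηs s := by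
    intro s hs
    obtain ⟨u, hu, hu1, hu2⟩ := (hrv.1.and (Ioo_mem_nhdsGT hs.1)).exists
    exact hu.trans_le (hmono ⟨hu1.le, hu2.le.trans hs.2⟩ ⟨hs.1.le, hs.2⟩ hu2.le)
  have ht0 := tendsto_nhdsGT_zero_of_balance hmono hpos ht htlim
  have hlt0 : Tendsto (fun n => l * t n) atTop (𝓝[>] 0) := by
    refine tendsto_nhdsWithin_iff.2 ⟨?_, ?_⟩
    · simpa using (tendsto_nhdsWithin_iff.1 ht0).1.const_mul l
    · filter_upwards [(tendsto_nhdsWithin_iff.1 ht0).2] with n hn using mul_pos hl hn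
  have hratio : Tendsto (fun n => ηs (l * t n) / ηs (t n)) atTop (𝓝 (l ^ ρ)) :=
    (hrv.2 l hl).comp ht0
  have hu := ENNReal.tendsto_ofReal (hratio.mul_const (1 - 20 * √l))
  rw [← hu.liminf_eq]
  refine liminf_le_liminf ?_
  filter_upwards [(hlim.comp hlt0).eventually (gt_mem_nhds (show (0 : ℝ) < 1 / 4 by norm_num)),
    (tendsto_nhdsWithin_iff.1 ht0).2,
    (htlim.pow 2).eventually (gt_mem_nhds (show (1 : ℝ) ^ 2 < 2 by norm_num))] with n h4 hn h2
  have hn0 : 0 < t n := hn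
  have hτ : 0 < l * t n := mul_pos hl hn0
  have hτt : l * t n ≤ t n := by nlinarith
  have hτπ : l * t n ≤ Real.pi := hτt.trans (ht n).2
  have hle : ηs (l * t n) ≤ ηs (t n) := hmono ⟨hτ.le, hτπ⟩ (ht n) hτt
  have hη0 := hpos _ ⟨hτ, hτπ⟩
  have hs : (20 * √l) ^ 2 = 400 * l := by rw [mul_pow, Real.sq_sqrt hl.le]; norm_num
  refine le_svMinimaxRisk_gaussianLaws hτ hτπ hpos (fun s hs => hmono ⟨hτ.le, hτπ⟩
    ⟨hτ.le.trans hs.1, hs.2⟩ hs.1) (le_of_lt h4) (hη0.trans_le hle) (by positivity) ?_ ?_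
  · rw [hs]; linarith
  · rw [hs]
    rw [mul_pow, Real.sq_sqrt (by positivity)] at h2
    have h3 : ηs (l * t n) ^ 2 ≤ ηs (t n) ^ 2 := pow_le_pow_left₀ hη0.le hle 2
    calc 200 * (n * ηs (l * t n) ^ 2 * (l * t n))
        ≤ 200 * (n * ηs (t n) ^ 2 * (l * t n)) := by gcongr
      _ = 200 * l * (ηs (t n) ^ 2 * (n * t n)) := by ring
      _ ≤ 200 * l * 2 := by gcongr
      _ = 400 * l := by ring

end LongMemory

theorem theorem1 (ηs : ℝ → ℝ) (ρ : ℝ) (hρ : 0 ≤ ρ)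
    (hmono : MonotoneOn ηs (Set.Icc 0 Real.pi))
    (hrv : LongMemory.RegularlyVaryingAtZero ηs ρ)
    (hlim : Filter.Tendsto ηs (𝓝[>] (0 : ℝ)) (𝓝 0))
    (t : ℕ → ℝ) (ht : ∀ n, t n ∈ Set.Icc 0 Real.pi)
    (htlim : Filter.Tendsto (fun n : ℕ => ηs (t n) * Real.sqrt (n * t n)) Filter.atTop (𝓝 1)) :
    (0 < ρ →
      0 < Filter.liminf
        (fun n : ℕ => LongMemory.svMinimaxRisk LongMemory.gaussianLaws ηs (ηs (t n)) n)
        Filter.atTop ∧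
      0 < Filter.liminf
        (fun n : ℕ => LongMemory.svMinimaxRisk LongMemory.stationaryLaws ηs (ηs (t n)) n)
        Filter.atTop) ∧
    (ρ = 0 →
      1 ≤ Filter.liminf
        (fun n : ℕ => LongMemory.svMinimaxRisk LongMemory.gaussianLaws ηs (ηs (t n)) n)
        Filter.atTop ∧
      1 ≤ Filter.liminf
        (fun n : ℕ => LongMemory.svMinimaxRisk LongMemory.stationaryLaws ηs (ηs (t n)) n)
        Filter.atTop) := by
  have hmain := fun l : ℝ => LongMemory.le_liminf_svMinimaxRisk hmono hrv hlim ht htlim (l := l)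
  have hsub : Filter.liminf
        (fun n : ℕ => LongMemory.svMinimaxRisk LongMemory.gaussianLaws ηs (ηs (t n)) n)
        Filter.atTop ≤ Filter.liminf
        (fun n : ℕ => LongMemory.svMinimaxRisk LongMemory.stationaryLaws ηs (ηs (t n)) n)
        Filter.atTop :=
    liminf_le_liminf (Eventually.of_forall fun n =>
      LongMemory.svMinimaxRisk_mono (fun _ _ hP => hP.1) _ _ _)
  refine ⟨fun _ => ?_, fun h0 => ?_⟩
  -- At `l = 1 / 1600` the factor `1 - 20 √l` equals `1 / 2`.
  · have h := hmain (1 / 1600) (by norm_num) (by norm_num)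
    have hsq : √(1 / 1600 : ℝ) = 1 / 40 := by
      rw [show (1 / 1600 : ℝ) = (1 / 40) ^ 2 by norm_num, Real.sqrt_sq (by norm_num)]
    have hp : 0 < ENNReal.ofReal ((1 / 1600 : ℝ) ^ ρ * (1 - 20 * √(1 / 1600 : ℝ))) := by
      rw [ENNReal.ofReal_pos, hsq]
      have := Real.rpow_pos_of_pos (show (0 : ℝ) < 1 / 1600 by norm_num) ρ
      linarith
    exact ⟨hp.trans_le h, hp.trans_le (h.trans hsub)⟩
  · subst h0
    have hc : Tendsto (fun l : ℝ => ENNReal.ofReal (l ^ (0 : ℝ) * (1 - 20 * √l))) (𝓝[>] 0)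
        (𝓝 1) := by
      have : Tendsto (fun l : ℝ => l ^ (0 : ℝ) * (1 - 20 * √l)) (𝓝 0) (𝓝 1) := by
        have hcont : Continuous fun l : ℝ => 1 - 20 * √l := by fun_prop
        simpa using hcont.tendsto 0
      simpa using ENNReal.tendsto_ofReal (this.mono_left nhdsWithin_le_nhds)
    have h1 := le_of_tendsto hc (by
      filter_upwards [Ioo_mem_nhdsGT (show (0 : ℝ) < 1 / 800 by norm_num)] with l hl
      exact hmain l hl.1 hl.2.le)
    exact ⟨h1, h1.trans hsub⟩
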